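/- Let $(M^7,H)$ be a quaternionic contact structure: $H$ is an oriented distribution of codimension $3$ on a smooth $7$-manifold $M$ such that the restrictions $d\eta|_{H_x}$, for $\eta$ a local one-form vanishing on $H$, form a subbundle $\Lambda^2_+H^*\subset\Lambda^2H^*$ of rank $3$ on which the exterior product $\Lambda^2H^*\otimes\Lambda^2H^*\to\Lambda^4H^*\simeq\mathbb R$ is positive definite. Let $g$ be a compatible metric on $H$, i.e. a metric for which $\Lambda^2_+H^*$ is the bundle of selfdual $2$-forms. Locally choose one-forms $\eta_1,\eta_2,\eta_3$ vanishing on $H$ and a quaternionic structure $(I_1,I_2,I_3)$ on $H$ (so $I_i^2=-1$, $I_1I_2=-I_2I_1=I_3$) with $w_i:=d\eta_i|_H=g(I_i\cdot,\cdot)$. For a complement $W$ of $H$ in $TM$, with the metric $\sum_i\eta_i^2$ and the basis $(R_i)$ dual to $(\eta_i)$, let $\nabla$ be the unique connection on $TM$ that preserves the splitting $TM=H\oplus W$ and the metrics of $H$ and $W$ and whose torsion $T_{X,Y}=\nabla_XY-\nabla_YX-[X,Y]$ satisfies, for $X,Y\in H$ and $R,R'\in W$: $(T_{X,Y})_H=0$,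 $(T_{R,R'})_W=0$, $T^W_X:=(R\mapsto (T_{X,R})_W)\in\mathfrak{so}(W)^\perp$ and $T^H_R:=(X\mapsto (T_{R,X})_H)\in\mathfrak{so}(H)^\perp$ (that is, both endomorphisms are symmetric). Through $W\simeq\Lambda^2_+H^*$, $R_i\mapsto w_i$, view $T^W$ as a section of $H^*\otimes\mathrm{End}(\Lambda^2_+H^*)\simeq H^*\otimes\Lambda^2_+H^*\otimes\Lambda^2_+H^*$. Let $S^{4,0}\subset\Lambda^2_+H^*\otimes\Lambda^2_+H^*$ be the symmetric trace-free tensors, let $$S^{5,1}=\Big\{\textstyle\sum_{i,j}a_{ij}\otimes w_i\otimes w_j\ :\ a_{ij}=a_{ji}\in H,\ \sum_iI_ia_{ij}=0\ \text{ for all } j\Big\}$$ (with $H\simeq H^*$ via $g$), and let $S^{6,0}$ be the totally symmetric trace-free tensors in $(\Lambda^2_+H^*)^{\otimes3}$. Let $W$ be the complement adapted to $g$, i.e. the unique one for which $T^W$ is a section of $S^{5,1}$, and $\nabla$ the corresponding connection. Then $T^W$, the vertical torsion, is a section of $S^{5,1}\subset H^*\otimes S^{4,0}$, and it satisfies the Bianchi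 identity $$\mathcal B_H(T^W)=0,$$ where $\mathcal B_H:\Gamma(H^*\otimes S^{4,0})\to\Gamma(S^{6,0})$ is the composition of $d^\nabla:\Gamma(H^*\otimes S^{4,0})\to\Gamma(\Lambda^2H^*\otimes S^{4,0})$, $(d^\nabla\sigma)(X,Y)=(\nabla_X\sigma)_Y-(\nabla_Y\sigma)_X$ for $X,Y\in H$, with the projection onto $S^{6,0}$ (orthogonal projection of $\Lambda^2H^*$ onto $\Lambda^2_+H^*$ followed by that of $\Lambda^2_+H^*\otimes S^{4,0}$ onto $S^{6,0}$). -/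

import Mathlib

open scoped Manifold ContDiff

noncomputable section

namespace QC

/-- The model space of a 7-dimensional manifold. -/
abbrev E7 := EuclideanSpace ℝ (Fin 7)

/-! ### Vector fields, one-forms, exterior derivative, distributions -/

section Basics

variable {M : Type*} [TopologicalSpace M] [ChartedSpace E7 M] [IsManifold (𝓡 7) ∞ M]

/-- The vector field `X` is smooth on `U`. -/
def SmoothField (X : (x : M) → TangentSpace (𝓡 7) x) (U : Set M) : Prop :=
  ContMDiffOn (𝓡 7) (𝓡 7).tangent ∞ (fun x => (⟨x, X x⟩ : TangentBundle (𝓡 7) M)) U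

/-- The one-form `η` is smooth on `U` (as a section of the cotangent bundle). -/
def SmoothForm (η : (x : M) → TangentSpace (𝓡 7) x →L[ℝ] ℝ) (U : Set M) : Prop :=
  ContMDiffOn (𝓡 7) ((𝓡 7).prod 𝓘(ℝ, E7 →L[ℝ] ℝ)) ∞
    (fun x => (⟨x, η x⟩ : Bundle.TotalSpace (E7 →L[ℝ] ℝ)
      (fun x : M => TangentSpace (𝓡 7) x →L[ℝ] Bundle.Trivial M ℝ x))) U

/-- The derivative `v(f)` of a function `f` at `x` along the tangent vector `v`. -/
def dirDeriv (f : M → ℝ) (x : M) (v : TangentSpace (𝓡 7) x) : ℝ :=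
  mvfderiv (𝓡 7) f x v

/-- The exterior derivative on vector fields,
`dη(X, Y) = X(η(Y)) - Y(η(X)) - η([X, Y])`. -/
def extDerivFields (η : (x : M) → TangentSpace (𝓡 7) x →L[ℝ] ℝ)
    (X Y : (x : M) → TangentSpace (𝓡 7) x) (x : M) : ℝ :=
  dirDeriv (fun y => η y (Y y)) x (X x) - dirDeriv (fun y => η y (X y)) x (Y x)
    - η x (VectorField.mlieBracket (𝓡 7) X Y x)

/-- The value `(dη)_x(v, w)` of the exterior derivative on two tangent vectors, computed on
extensions of `v` and `w` that are smooth near `x`. -/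
def extDeriv (η : (x : M) → TangentSpace (𝓡 7) x →L[ℝ] ℝ) (x : M)
    (v w : TangentSpace (𝓡 7) x) : ℝ :=
  extDerivFields η (FiberBundle.extend E7 v) (FiberBundle.extend E7 w) x

/-- A smooth distribution of rank `k`: near every point it is spanned by a smooth frame. -/
def IsSmoothDistribution (k : ℕ) (D : (x : M) → Submodule ℝ (TangentSpace (𝓡 7) x)) : Prop :=
  ∀ x : M, ∃ U : Set M, IsOpen U ∧ x ∈ U ∧
    ∃ s : Fin k → (y : M) → TangentSpace (𝓡 7) y, (∀ i, SmoothField (s i) U) ∧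
      ∀ y ∈ U, LinearIndependent ℝ (fun i => s i y) ∧
        Submodule.span ℝ (Set.range fun i => s i y) = D y

end Basics

/-! ### Four-dimensional linear algebra -/

section LinearAlgebra

variable {V : Type*} [AddCommGroup V] [Module ℝ V]

/-- The value of `β ∧ β'` on the basis `b` of a four-dimensional space. -/
def wedge (β β' : LinearMap.BilinForm ℝ V) (b : Module.Basis (Fin 4) ℝ V) : ℝ :=
  β (b 0) (b 1) * β' (b 2) (b 3) - β (b 0) (b 2) * β' (b 1) (b 3)
    + β (b 0) (b 3) * β' (b 1) (b 2) + β (b 1) (b 2) * β' (b 0) (b 3)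
    - β (b 1) (b 3) * β' (b 0) (b 2) + β (b 2) (b 3) * β' (b 0) (b 1)

/-- The basis `b` is orthonormal for `g`. -/
def IsOrthonormal (g : LinearMap.BilinForm ℝ V) (b : Module.Basis (Fin 4) ℝ V) : Prop :=
  ∀ i j, g (b i) (b j) = if i = j then 1 else 0

/-- The 2-form `β` is selfdual for the metric `g` and the orientation `o`. -/
def IsSelfDual (g : LinearMap.BilinForm ℝ V) (o : Orientation ℝ V (Fin 4))
    (β : LinearMap.BilinForm ℝ V) : Prop :=
  ∀ b : Module.Basis (Fin 4) ℝ V, b.orientation = o → IsOrthonormal g b →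
    β (b 0) (b 1) = β (b 2) (b 3) ∧ β (b 0) (b 2) = - β (b 1) (b 3) ∧
      β (b 0) (b 3) = β (b 1) (b 2)

/-- A quaternionic structure on `V`: three complex structures with `I₁I₂ = -I₂I₁ = I₃`. -/
def IsQuaternionic (J : Fin 3 → V →ₗ[ℝ] V) : Prop :=
  (∀ i v, J i (J i v) = -v) ∧ (∀ v, J 0 (J 1 v) = J 2 v) ∧ (∀ v, J 1 (J 0 v) = - J 2 v)

/-- The element `∑ c i j ⊗ w_i ⊗ w_j` of `V* ⊗ Λ²₊ ⊗ Λ²₊`, where `w_i = g(I_i ·, ·)`, as a tensor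
with five arguments `(X; Y₁, Y₂; Z₁, Z₂)`. -/
def tensorOfCoeff (g : LinearMap.BilinForm ℝ V) (J : Fin 3 → V →ₗ[ℝ] V)
    (c : Fin 3 → Fin 3 → V → ℝ) (X : Fin 5 → V) : ℝ :=
  ∑ i, ∑ j, c i j (X 0) * g (J i (X 1)) (X 2) * g (J j (X 3)) (X 4)

/-- `τ ∈ V* ⊗ S^{4,0}`, where `S^{4,0} ⊂ Λ²₊ ⊗ Λ²₊` is the space of symmetric trace-free tensors. -/
def MemDualS40 (g : LinearMap.BilinForm ℝ V) (J : Fin 3 → V →ₗ[ℝ] V)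
    (τ : (Fin 5 → V) → ℝ) : Prop :=
  ∃ c : Fin 3 → Fin 3 → V →ₗ[ℝ] ℝ, (∀ i j, c i j = c j i) ∧ (∑ i, c i i = 0) ∧
    τ = tensorOfCoeff g J (fun i j => c i j)

/-- `τ ∈ S^{5,1} = {∑ a i j ⊗ I_i ⊗ I_j | a i j = a j i ∈ V, ∑ i, I_i (a i j) = 0 for all j}`,
where `V` is identified with its dual and `I_i` with `w_i` through `g`. -/
def MemS51 (g : LinearMap.BilinForm ℝ V) (J : Fin 3 → V →ₗ[ℝ] V)
    (τ : (Fin 5 → V) → ℝ) : Prop :=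
  ∃ a : Fin 3 → Fin 3 → V, (∀ i j, a i j = a j i) ∧ (∀ j, ∑ i, J i (a i j) = 0) ∧
    τ = tensorOfCoeff g J (fun i j => g (a i j))

/-- Orthogonal projection `Λ²V* ⊗ Λ²₊ ⊗ Λ²₊ → Λ²₊ ⊗ Λ²₊ ⊗ Λ²₊`: the coefficient on
`w_k ⊗ w_i ⊗ w_j`. The form `w_k` has norm `√2`, and for a 2-form `β`
the coefficient of its selfdual part on `w_k` is `⟨β, w_k⟩ / 2 = (∑ a, β(e_a, I_k e_a)) / 4`, where
`e` is an orthonormal basis. -/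
def selfDualCoeff (J : Fin 3 → V →ₗ[ℝ] V) (e : Module.Basis (Fin 4) ℝ V)
    (D : V → V → (Fin 4 → V) → ℝ) (k i j : Fin 3) : ℝ :=
  (1 / 64) * ∑ a, ∑ b, ∑ c, D (e a) (J k (e a)) ![e b, J i (e b), e c, J j (e c)]

end LinearAlgebra

/-- The projection of `⊗³ ℝ³` onto the symmetric tensors. -/
def sym3 (C : Fin 3 → Fin 3 → Fin 3 → ℝ) (i j k : Fin 3) : ℝ :=
  (C i j k + C i k j + C j i k + C j k i + C k i j + C k j i) / 6

/-- The projection of `⊗³ ℝ³` onto the symmetric trace-free tensors. With `ℝ³ = Λ²₊ = S^{2,0}` (in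
an orthogonal basis of vectors of equal length) this is the projection onto `S^{6,0}`. -/
def projS60 (C : Fin 3 → Fin 3 → Fin 3 → ℝ) (i j k : Fin 3) : ℝ :=
  sym3 C i j k - (1 / 5) * ((if i = j then ∑ l, sym3 C l l k else 0)
    + (if i = k then ∑ l, sym3 C l l j else 0) + (if j = k then ∑ l, sym3 C l l i else 0))

/-! ### Quaternionic contact structures in dimension 7 -/

section Structures

variable (M : Type*) [TopologicalSpace M] [ChartedSpace E7 M] [IsManifold (𝓡 7) ∞ M]

/-- An oriented smooth distribution of codimension 3 on a 7-manifold: near every point there is a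
smooth positively oriented frame. -/
structure OrientedDistribution where
  fiber : (x : M) → Submodule ℝ (TangentSpace (𝓡 7) x)
  orientation : (x : M) → Orientation ℝ (fiber x) (Fin 4)
  smooth : ∀ x : M, ∃ U : Set M, IsOpen U ∧ x ∈ U ∧
    ∃ s : Fin 4 → (y : M) → TangentSpace (𝓡 7) y, (∀ i, SmoothField (s i) U) ∧
      ∀ y ∈ U, ∃ b : Module.Basis (Fin 4) ℝ (fiber y),
        (∀ i, (b i : TangentSpace (𝓡 7) y) = s i y) ∧ b.orientation = orientation y

variable {M}

/-- `Λ²₊ H*_x`: the restrictions to `H_x` of the forms `dη`, for `η` a one-form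
near `x` that vanishes on `H`. -/
def OrientedDistribution.lambdaPlus (H : OrientedDistribution M) (x : M) :
    Set (LinearMap.BilinForm ℝ (H.fiber x)) :=
  {β | ∃ (U : Set M) (η : (y : M) → TangentSpace (𝓡 7) y →L[ℝ] ℝ), IsOpen U ∧ x ∈ U ∧
    SmoothForm η U ∧ (∀ y ∈ U, ∀ v ∈ H.fiber y, η y v = 0) ∧
    ∀ v w : H.fiber x, β v w = extDeriv η x v w}

variable (M) in
/-- A quaternionic contact structure on a 7-manifold. -/
structure QCStructure extends OrientedDistribution M where
  rank_three : ∀ x,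
    Module.finrank ℝ (Submodule.span ℝ (toOrientedDistribution.lambdaPlus x)) = 3
  wedge_pos : ∀ x, ∀ β ∈ toOrientedDistribution.lambdaPlus x, β ≠ 0 →
    ∀ b : Module.Basis (Fin 4) ℝ (fiber x), b.orientation = orientation x → 0 < wedge β β b

/-- A section `X` of the distribution `D` is smooth on `U`. -/
def SmoothSection {D : (x : M) → Submodule ℝ (TangentSpace (𝓡 7) x)} (X : (x : M) → D x)
    (U : Set M) : Prop :=
  SmoothField (fun x => (X x : TangentSpace (𝓡 7) x)) U

/-- A compatible (Carnot-Carathéodory) metric: a smooth metric on `H` in the conformal class for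
which the selfdual 2-forms are the elements of `Λ²₊ H*`. -/
structure CompatibleMetric (Q : QCStructure M) where
  form : (x : M) → LinearMap.BilinForm ℝ (Q.fiber x)
  symm : ∀ x v w, form x v w = form x w v
  pos : ∀ x v, v ≠ 0 → 0 < form x v v
  smooth : ∀ (U : Set M) (X Y : (x : M) → Q.fiber x), IsOpen U → SmoothSection X U →
    SmoothSection Y U → ContMDiffOn (𝓡 7) 𝓘(ℝ, ℝ) ∞ (fun x => form x (X x) (Y x)) U
  selfDual : ∀ x, ∀ β : LinearMap.BilinForm ℝ (Q.fiber x), β.IsAlt →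
    (β ∈ Q.lambdaPlus x ↔ IsSelfDual (form x) (Q.orientation x) β)

/-- A complementary distribution `W`, so that `TM = H ⊕ W`. -/
structure Complement (Q : QCStructure M) where
  fiber : (x : M) → Submodule ℝ (TangentSpace (𝓡 7) x)
  smooth : IsSmoothDistribution 3 fiber
  isCompl : ∀ x, IsCompl (Q.fiber x) (fiber x)

variable {Q : QCStructure M}

/-- The projection of `T_xM` on `H_x` in the direction of `W_x`. -/
def Complement.projH (W : Complement Q) (x : M) : TangentSpace (𝓡 7) x →ₗ[ℝ] Q.fiber x :=
  (Q.fiber x).projectionOnto (W.fiber x) (W.isCompl x)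

/-- The projection of `T_xM` on `W_x` in the direction of `H_x`. -/
def Complement.projW (W : Complement Q) (x : M) : TangentSpace (𝓡 7) x →ₗ[ℝ] W.fiber x :=
  (W.fiber x).projectionOnto (Q.fiber x) (W.isCompl x).symm

/-- An adapted local frame on an open set `U`: local contact forms `(η₁, η₂, η₃)` and a quaternionic
structure `(I₁, I₂, I₃)` on `H` with `dη_i = g(I_i ·, ·)` on `H`, and the basis `(R₁, R₂, R₃)` of `W`
which is dual to `(η₁, η₂, η₃)`. -/
structure AdaptedFrame (g : CompatibleMetric Q) (W : Complement Q) (U : Set M) where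
  η : Fin 3 → (x : M) → TangentSpace (𝓡 7) x →L[ℝ] ℝ
  J : Fin 3 → (x : M) → Q.fiber x →ₗ[ℝ] Q.fiber x
  R : Fin 3 → (x : M) → W.fiber x
  isOpen : IsOpen U
  smooth : ∀ i, SmoothForm (η i) U
  vanish : ∀ i, ∀ x ∈ U, ∀ v ∈ Q.fiber x, η i x v = 0
  quaternionic : ∀ x ∈ U, IsQuaternionic (fun i => J i x)
  extDeriv_eq : ∀ i, ∀ x ∈ U, ∀ v w : Q.fiber x, extDeriv (η i) x v w = g.form x (J i x v) w
  dual : ∀ i j, ∀ x ∈ U, η j x (R i x) = if i = j then 1 else 0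

/-- The metric `∑ η_i²` on `W`. -/
def AdaptedFrame.metricW {g : CompatibleMetric Q} {W : Complement Q} {U : Set M}
    (F : AdaptedFrame g W U) (x : M) (v w : W.fiber x) : ℝ :=
  ∑ i, F.η i x v * F.η i x w

/-- Connections on `TM`. -/
abbrev Connection (M : Type*) [TopologicalSpace M] [ChartedSpace E7 M]
    [IsManifold (𝓡 7) ∞ M] :=
  CovariantDerivative (𝓡 7) E7 (TangentSpace (𝓡 7) : M → Type _)

/-- `T^W_X : R ↦ (T_{X,R})_W`, for `X ∈ H`, as an endomorphism of `W`; here `T` is the torsion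
`T_{X,Y} = ∇_X Y - ∇_Y X - [X, Y]`. -/
def torsionW (W : Complement Q) (cov : Connection M) (x : M) (X : Q.fiber x) (R : W.fiber x) :
    W.fiber x :=
  W.projW x (cov.torsion x X R)

/-- `T^H_R : X ↦ (T_{R,X})_H`, for `R ∈ W`, as an endomorphism of `H`. -/
def torsionH (W : Complement Q) (cov : Connection M) (x : M) (R : W.fiber x) (X : Q.fiber x) :
    Q.fiber x :=
  W.projH x (cov.torsion x R X)

/-- The smooth connection `∇` is the connection `∇^W` associated to `g` and to the complement `W`.
The orthogonal of `𝔰𝔬` in the space of endomorphisms is the space of symmetric endomorphisms. -/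
structure IsAssociatedConnection (g : CompatibleMetric Q) (W : Complement Q)
    (cov : Connection M) : Prop where
  smooth : CovariantDerivative.ContMDiffCovariantDerivative cov ∞
  preserves_H : ∀ (U : Set M) (X : (x : M) → Q.fiber x), IsOpen U → SmoothSection X U →
    ∀ x ∈ U, ∀ v, cov (fun y => (X y : TangentSpace (𝓡 7) y)) x v ∈ Q.fiber x
  preserves_W : ∀ (U : Set M) (R : (x : M) → W.fiber x), IsOpen U → SmoothSection R U →
    ∀ x ∈ U, ∀ v, cov (fun y => (R y : TangentSpace (𝓡 7) y)) x v ∈ W.fiber x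
  metric_H : ∀ (U : Set M) (X Y : (x : M) → Q.fiber x), IsOpen U → SmoothSection X U →
    SmoothSection Y U → ∀ x ∈ U, ∀ v,
      dirDeriv (fun y => g.form y (X y) (Y y)) x v =
        g.form x (W.projH x (cov (fun y => (X y : TangentSpace (𝓡 7) y)) x v)) (Y x)
        + g.form x (X x) (W.projH x (cov (fun y => (Y y : TangentSpace (𝓡 7) y)) x v))
  metric_W : ∀ (U : Set M) (F : AdaptedFrame g W U) (R S : (x : M) → W.fiber x),
    SmoothSection R U → SmoothSection S U → ∀ x ∈ U, ∀ v,
      dirDeriv (fun y => F.metricW y (R y) (S y)) x v =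
        F.metricW x (W.projW x (cov (fun y => (R y : TangentSpace (𝓡 7) y)) x v)) (S x)
        + F.metricW x (R x) (W.projW x (cov (fun y => (S y : TangentSpace (𝓡 7) y)) x v))
  torsion_HH : ∀ x (X Y : Q.fiber x), W.projH x (cov.torsion x X Y) = 0
  torsion_WW : ∀ x (R S : W.fiber x), W.projW x (cov.torsion x R S) = 0
  torsionW_symm : ∀ (U : Set M) (F : AdaptedFrame g W U), ∀ x ∈ U, ∀ (X : Q.fiber x)
    (R S : W.fiber x),
      F.metricW x (torsionW W cov x X R) S = F.metricW x R (torsionW W cov x X S)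
  torsionH_symm : ∀ x (R : W.fiber x) (X Y : Q.fiber x),
    g.form x (torsionH W cov x R X) Y = g.form x X (torsionH W cov x R Y)

/-- The vertical torsion `T^W` on `U` as a section of `H* ⊗ End(Λ²₊ H*) = H* ⊗ Λ²₊ H* ⊗ Λ²₊ H*`,
through the identification `W ≃ Λ²₊ H*`, `R_i ↦ w_i = dη_i|_H`. It is
`∑ η_j(T^W_X R_i) w_i ⊗ w_j`; the metric on `Λ²₊ H*` that identifies it with its dual is the
one for which `(w_i)` is orthonormal. -/
def AdaptedFrame.verticalTorsion {g : CompatibleMetric Q} {W : Complement Q} {U : Set M}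
    (F : AdaptedFrame g W U) (cov : Connection M) (x : M) : (Fin 5 → Q.fiber x) → ℝ :=
  tensorOfCoeff (g.form x) (fun i => F.J i x)
    (fun i j X => F.η j x (torsionW W cov x X (F.R i x)))

/-- `W` is the complement adapted to `g`: the vertical torsion is a section of `S^{5,1}`. -/
def IsAdaptedComplement (g : CompatibleMetric Q) (W : Complement Q) (cov : Connection M) :
    Prop :=
  ∀ (U : Set M) (F : AdaptedFrame g W U), ∀ x ∈ U,
    MemS51 (g.form x) (fun i => F.J i x) (F.verticalTorsion cov x)

/-! ### The Bianchi operator -/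

/-- A local section of `H`, smooth near `x`, with value `v` at `x`. -/
def extendH (W : Complement Q) {x : M} (v : Q.fiber x) (y : M) : Q.fiber y :=
  W.projH y (FiberBundle.extend E7 (v : TangentSpace (𝓡 7) x) y)

/-- The covariant derivative of a section `σ` of `⊗ⁿ H*`:
`(∇_v σ)(Y₁, …, Y_n) = v(σ(Y₁, …, Y_n)) - ∑ i, σ(Y₁, …, ∇_v Y_i, …, Y_n)`. -/
def covTensor (W : Complement Q) (cov : Connection M) {n : ℕ}
    (σ : (x : M) → (Fin n → Q.fiber x) → ℝ) (x : M) (v : TangentSpace (𝓡 7) x)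
    (Y : Fin n → Q.fiber x) : ℝ :=
  dirDeriv (fun y => σ y (fun i => extendH W (Y i) y)) x v
    - ∑ i, σ x (Function.update Y i
        (W.projH x (cov (fun y => (extendH W (Y i) y : TangentSpace (𝓡 7) y)) x v)))

/-- `d^∇` on the sections of `H* ⊗ E`, where `E ⊂ ⊗ⁿ H*`:
`(d^∇ σ)(X, Y) = (∇_X σ)_Y - (∇_Y σ)_X` for `X, Y ∈ H`. -/
def dNabla (W : Complement Q) (cov : Connection M) {n : ℕ}
    (σ : (x : M) → (Fin (n + 1) → Q.fiber x) → ℝ) (x : M) (X Y : Q.fiber x)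
    (Z : Fin n → Q.fiber x) : ℝ :=
  covTensor W cov σ x X (Fin.cons Y Z) - covTensor W cov σ x Y (Fin.cons X Z)

/-- The operator `𝓑_H`: `d^∇` followed by the projection of `Λ²H* ⊗ S^{4,0}` on `S^{6,0}`, in the
basis of `Λ²₊ H*_x` given by the quaternionic structure `J`; `e` is any orthonormal basis
of `H_x`. -/
def bianchiOp (W : Complement Q) (cov : Connection M)
    (σ : (x : M) → (Fin 5 → Q.fiber x) → ℝ) (x : M) (J : Fin 3 → Q.fiber x →ₗ[ℝ] Q.fiber x)
    (e : Module.Basis (Fin 4) ℝ (Q.fiber x)) : Fin 3 → Fin 3 → Fin 3 → ℝ :=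
  projS60 (selfDualCoeff J e (dNabla W cov σ x))

end Structures

end QC

end

/-!
The vertical torsion of the connection attached to an adapted complement satisfies the Bianchi
identity because that identity is, up to terms without component in `S^{6,0}`, the first Bianchi
identity of a connection with torsion. Both components of it that are needed are the relation
`d(dη_j) = 0` for the contact forms, evaluated on sections of `H` and on the fields `R_i`. On all
these fields `η_j` is constant, so that `d(dη_j) = 0` is just the Jacobi identity
(`extDeriv_extDeriv_of_const`).

Write `θ` for the connection form of `W`, `w_i = g(I_i ·, ·)`, and `T_{ij}(X) = η_j(T^W_X R_i)`,
which is symmetric in `i, j`. Since `∇` preserves `g`, each `∇_v I_i` is skew, and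
the quaternionic relations force it to be an infinitesimal rotation of `(I_1, I_2, I_3)`:
`∇_v w_j = ∑ c_{jk}(v) w_k` with `c` antisymmetric (`IsHyperhermitian.derivation_eq`).

On three sections of `H` (`bianchi_H_H_H`), `d(dη_j) = 0` reads
`∑_k (c_{jk} - θ_{jk} - T_{jk}) ∧ w_k = 0`, that is `∑_k I_k (c_{jk} - θ_{jk} - T_{jk}) = 0` on `H`.
The torsion drops out by the relation which defines `S^{5,1}`, and an antisymmetric family with
this property is zero (`antisymm_eq_zero`). So `c = θ` on `H`: the identification `R_i ↦ w_i` is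
parallel in the directions of `H` (`covJ_H`), and the covariant derivative of `T^W` as a section of
`H* ⊗ Λ²₊ ⊗ Λ²₊` is its covariant derivative as a section of `H* ⊗ End W`.

On two sections of `H` and a field `R_i` (`bianchi_H_H_R`), symmetrised in `i, j`, the relation
expresses `d^∇ T^W` by three terms (`dvt_sub_swap`). After the projection of `Λ²H*` on `Λ²₊ H*` with
index `k`, the coefficients of `∇_{R_i} w_j` are antisymmetric in `j, k`, the coefficients of `θ`
along `W` are antisymmetric in `j, k` as well, and the term in the symmetric endomorphism
`T^H_{R_i}` is its trace times `δ_{jk}`, because the trace-free part of a symmetric endomorphism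
only contributes an antiselfdual form (`IsHyperhermitian.sum_symm`). Antisymmetric terms and
symmetrised multiples of `δ` have no component in `S^{6,0}`.
-/

noncomputable section

namespace QC

open VectorField

/-! ### Derivatives of functions, vector fields and one-forms -/

section Derivatives

variable {M : Type*} [TopologicalSpace M] [ChartedSpace E7 M] {V : Set M} {x : M}
  {X Y : (x : M) → TangentSpace (𝓡 7) x} {η : (x : M) → TangentSpace (𝓡 7) x →L[ℝ] ℝ}

theorem dirDeriv_congr {f h : M → ℝ} (hV : IsOpen V) (hx : x ∈ V) (hfh : ∀ y ∈ V, f y = h y)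
    (v : TangentSpace (𝓡 7) x) : dirDeriv f x v = dirDeriv h x v := by
  have : f =ᶠ[nhds x] h := Filter.eventually_of_mem (hV.mem_nhds hx) hfh
  simp only [dirDeriv, mvfderiv, this.mfderiv_eq]
  rfl

theorem dirDeriv_eq_zero {f : M → ℝ} (hV : IsOpen V) (hx : x ∈ V) (c : ℝ)
    (hf : ∀ y ∈ V, f y = c) (v : TangentSpace (𝓡 7) x) : dirDeriv f x v = 0 := by
  rw [dirDeriv_congr hV hx hf, dirDeriv, mvfderiv_const]; rfl

theorem dirDeriv_sum {ι : Type*} (s : Finset ι) {f : ι → M → ℝ}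
    (hf : ∀ i, MDifferentiableAt (𝓡 7) 𝓘(ℝ, ℝ) (f i) x) (v : TangentSpace (𝓡 7) x) :
    MDifferentiableAt (𝓡 7) 𝓘(ℝ, ℝ) (fun y => ∑ i ∈ s, f i y) x ∧
      dirDeriv (fun y => ∑ i ∈ s, f i y) x v = ∑ i ∈ s, dirDeriv (f i) x v := by
  classical
  induction s using Finset.induction_on with
  | empty =>
    simp only [Finset.sum_empty, dirDeriv, mvfderiv_const]
    exact ⟨mdifferentiableAt_const, rfl⟩
  | insert a s ha ih =>
    simp only [Finset.sum_insert ha]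
    refine ⟨(hf a).add ih.1, ?_⟩
    rw [← ih.2]
    simp only [dirDeriv]
    rw [mvfderiv_fun_add (hf a) ih.1]
    rfl

theorem dirDeriv_mul {f h : M → ℝ} (hf : MDifferentiableAt (𝓡 7) 𝓘(ℝ, ℝ) f x)
    (hh : MDifferentiableAt (𝓡 7) 𝓘(ℝ, ℝ) h x) (v : TangentSpace (𝓡 7) x) :
    dirDeriv (fun y => f y * h y) x v = dirDeriv f x v * h x + f x * dirDeriv h x v := by
  simp only [dirDeriv]
  rw [mvfderiv_fun_mul hf hh]
  simp
  ring

theorem extDerivFields_swap (x : M) :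
    extDerivFields η X Y x = - extDerivFields η Y X x := by
  simp only [extDerivFields]
  rw [mlieBracket_swap_apply, map_neg]
  ring

theorem extDerivFields_of_const (hV : IsOpen V) (hx : x ∈ V) (a b : ℝ)
    (hX : ∀ y ∈ V, η y (X y) = a) (hY : ∀ y ∈ V, η y (Y y) = b) :
    extDerivFields η X Y x = - η x (VectorField.mlieBracket (𝓡 7) X Y x) := by
  rw [extDerivFields, dirDeriv_eq_zero hV hx _ hX, dirDeriv_eq_zero hV hx _ hY]
  ring

end Derivatives

section Calculus

variable {M : Type*} [TopologicalSpace M] [ChartedSpace E7 M] [IsManifold (𝓡 7) ∞ M]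
  {V : Set M} {x : M} {X Y Z : (x : M) → TangentSpace (𝓡 7) x}
  {η : (x : M) → TangentSpace (𝓡 7) x →L[ℝ] ℝ}

theorem SmoothField.contMDiffAt (hX : SmoothField X V) (hV : IsOpen V) (hx : x ∈ V) :
    ContMDiffAt (𝓡 7) (𝓡 7).tangent ∞ (fun x => (⟨x, X x⟩ : TangentBundle (𝓡 7) M)) x :=
  ContMDiffOn.contMDiffAt hX (hV.mem_nhds hx)

theorem SmoothField.mdifferentiableAt (hX : SmoothField X V) (hV : IsOpen V) (hx : x ∈ V) :
    MDifferentiableAt (𝓡 7) (𝓡 7).tangent (fun x => (⟨x, X x⟩ : TangentBundle (𝓡 7) M)) x :=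
  (hX.contMDiffAt hV hx).mdifferentiableAt (by simp)

theorem SmoothField.mono {U : Set M} (hX : SmoothField X U) (h : V ⊆ U) : SmoothField X V :=
  ContMDiffOn.mono hX h

theorem SmoothForm.mono {U : Set M} (hη : SmoothForm η U) (h : V ⊆ U) : SmoothForm η V :=
  ContMDiffOn.mono hη h

theorem SmoothField.congr (hX : SmoothField X V) (h : ∀ y ∈ V, Y y = X y) : SmoothField Y V :=
  ContMDiffOn.congr hX fun y hy => by rw [h y hy]

theorem SmoothField.add (hX : SmoothField X V) (hY : SmoothField Y V) : SmoothField (X + Y) V :=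
  ContMDiffOn.add_section hX hY

theorem SmoothField.sub (hX : SmoothField X V) (hY : SmoothField Y V) : SmoothField (X - Y) V :=
  ContMDiffOn.sub_section hX hY

theorem SmoothField.smul {f : M → ℝ} (hf : ContMDiffOn (𝓡 7) 𝓘(ℝ, ℝ) ∞ f V)
    (hX : SmoothField X V) : SmoothField (fun y => f y • X y) V :=
  ContMDiffOn.smul_section hf hX

theorem SmoothField.sum {ι : Type*} [Fintype ι] {X : ι → (x : M) → TangentSpace (𝓡 7) x}
    (hX : ∀ i, SmoothField (X i) V) : SmoothField (fun y => ∑ i, X i y) V :=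
  ContMDiffOn.sum_section fun i _ => hX i

theorem SmoothField.mlieBracket (hX : SmoothField X V) (hY : SmoothField Y V) (hV : IsOpen V) :
    SmoothField (mlieBracket (𝓡 7) X Y) V := by
  intro y hy
  have : IsManifold (𝓡 7) (((⊤ : ℕ∞) : WithTop ℕ∞) + 1) M := by
    simpa using (inferInstance : IsManifold (𝓡 7) ∞ M)
  have : IsManifold (𝓡 7) (minSmoothness ℝ 2) M := by
    simpa using (inferInstance : IsManifold (𝓡 7) 2 M)
  exact (ContMDiffAt.mlieBracket_vectorField (m := ⊤) (n := ⊤) (hX.contMDiffAt hV hy)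
    (hY.contMDiffAt hV hy) (by simp)).contMDiffWithinAt

theorem SmoothForm.contMDiffOn_apply (hη : SmoothForm η V) (hX : SmoothField X V) :
    ContMDiffOn (𝓡 7) 𝓘(ℝ, ℝ) ∞ (fun y => η y (X y)) V := by
  intro y hy
  have := ContMDiffWithinAt.clm_bundle_apply (F₁ := E7) (F₂ := ℝ)
    (E₁ := (TangentSpace (𝓡 7) : M → Type _)) (E₂ := Bundle.Trivial M ℝ) (b := fun x => x)
    (ϕ := η) (v := X) (hη y hy) (hX y hy)
  rw [Bundle.contMDiffWithinAt_section] at this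
  exact this

/-- Differentiability of a one-form at a point, as a section of the cotangent bundle. -/
def FormMDiffAt (η : (x : M) → TangentSpace (𝓡 7) x →L[ℝ] ℝ) (x : M) : Prop :=
  MDifferentiableAt (𝓡 7) ((𝓡 7).prod 𝓘(ℝ, E7 →L[ℝ] ℝ))
    (fun x => (⟨x, η x⟩ : Bundle.TotalSpace (E7 →L[ℝ] ℝ)
      (fun x : M => TangentSpace (𝓡 7) x →L[ℝ] Bundle.Trivial M ℝ x))) x

theorem SmoothForm.formMDiffAt (hη : SmoothForm η V) (hV : IsOpen V) (hx : x ∈ V) :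
    FormMDiffAt η x :=
  (ContMDiffOn.contMDiffAt hη (hV.mem_nhds hx)).mdifferentiableAt (by simp)

theorem FormMDiffAt.apply (hη : FormMDiffAt η x)
    (hX : MDifferentiableAt (𝓡 7) (𝓡 7).tangent
      (fun x => (⟨x, X x⟩ : TangentBundle (𝓡 7) M)) x) :
    MDifferentiableAt (𝓡 7) 𝓘(ℝ, ℝ) (fun y => η y (X y)) x := by
  have := MDifferentiableAt.clm_bundle_apply (F₁ := E7) (F₂ := ℝ)
    (E₁ := (TangentSpace (𝓡 7) : M → Type _)) (E₂ := Bundle.Trivial M ℝ) (b := fun x => x)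
    (ϕ := η) (v := X) hη hX
  rw [mdifferentiableAt_section] at this
  exact this

theorem tensorialAt_extDerivFields_left (hη : FormMDiffAt η x)
    (Y : (x : M) → TangentSpace (𝓡 7) x) :
    TensorialAt (𝓡 7) E7 (fun X => extDerivFields η X Y x) x where
  smul {f X} hf hX := by
    simp only [extDerivFields, dirDeriv, mlieBracket_smul_left hf hX]
    have h1 : (fun y => η y ((f • X) y)) = fun y => f y * η y (X y) := by
      ext y; simp
    rw [h1, mvfderiv_fun_mul hf (hη.apply hX)]
    simp
    ring
  add {X X'} hX hX' := by
    simp only [extDerivFields, dirDeriv, mlieBracket_add_left hX hX']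
    have h1 : (fun y => η y ((X + X') y)) = fun y => η y (X y) + η y (X' y) := by
      ext y; simp
    rw [h1, mvfderiv_fun_add (hη.apply hX) (hη.apply hX')]
    simp
    ring

theorem tensorialAt_extDerivFields_right (hη : FormMDiffAt η x)
    (X : (x : M) → TangentSpace (𝓡 7) x) :
    TensorialAt (𝓡 7) E7 (fun Y => extDerivFields η X Y x) x where
  smul hf hY := by
    rw [extDerivFields_swap, (tensorialAt_extDerivFields_left hη X).smul hf hY,
      extDerivFields_swap (Y := X)]
    simp
  add hY hY' := by
    rw [extDerivFields_swap, (tensorialAt_extDerivFields_left hη X).add hY hY',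
      extDerivFields_swap (Y := X), extDerivFields_swap (Y := X)]
    ring

/-- The exterior derivative of a one-form at a point, as a bilinear form on the tangent space. -/
def extDerivHom (hη : FormMDiffAt η x) :
    TangentSpace (𝓡 7) x →L[ℝ] TangentSpace (𝓡 7) x →L[ℝ] ℝ :=
  TensorialAt.mkHom₂ (fun X Y => extDerivFields η X Y x) x
    (fun Y _ => tensorialAt_extDerivFields_left hη Y)
    (fun X _ => tensorialAt_extDerivFields_right hη X)

/-- `extDeriv`, defined through one choice of extensions, is this bilinear form. -/
theorem extDerivHom_eq (hη : FormMDiffAt η x) (v w : TangentSpace (𝓡 7) x) :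
    extDerivHom hη v w = extDeriv η x v w := rfl

theorem extDerivHom_apply (hη : FormMDiffAt η x) (hV : IsOpen V) (hx : x ∈ V)
    (hX : SmoothField X V) (hY : SmoothField Y V) :
    extDerivHom hη (X x) (Y x) = extDerivFields η X Y x :=
  TensorialAt.mkHom₂_apply _ _ (hX.mdifferentiableAt hV hx) (hY.mdifferentiableAt hV hx)

theorem extDerivHom_swap (hη : FormMDiffAt η x) (v w : TangentSpace (𝓡 7) x) :
    extDerivHom hη v w = - extDerivHom hη w v :=
  extDerivFields_swap x

/-- The identity `d(dη) = 0`, on vector fields on which `η` is constant: it reduces to the Jacobi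
identity for the bracket. -/
theorem extDeriv_extDeriv_of_const (hη : SmoothForm η V) (hV : IsOpen V) (hx : x ∈ V)
    (hX : SmoothField X V) (hY : SmoothField Y V) (hZ : SmoothField Z V) {a b c : ℝ}
    (hηX : ∀ y ∈ V, η y (X y) = a) (hηY : ∀ y ∈ V, η y (Y y) = b)
    (hηZ : ∀ y ∈ V, η y (Z y) = c) :
    dirDeriv (fun y => extDerivFields η Y Z y) x (X x)
      + dirDeriv (fun y => extDerivFields η Z X y) x (Y x)
      + dirDeriv (fun y => extDerivFields η X Y y) x (Z x)
      = extDerivHom (hη.formMDiffAt hV hx) (VectorField.mlieBracket (𝓡 7) X Y x) (Z x)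
        + extDerivHom (hη.formMDiffAt hV hx) (VectorField.mlieBracket (𝓡 7) Y Z x) (X x)
        + extDerivHom (hη.formMDiffAt hV hx) (VectorField.mlieBracket (𝓡 7) Z X x) (Y x) := by
  have hbr : ∀ {P Q R : (x : M) → TangentSpace (𝓡 7) x} {d : ℝ}, SmoothField P V →
      SmoothField Q V → SmoothField R V → (∀ y ∈ V, η y (R y) = d) →
      extDerivHom (hη.formMDiffAt hV hx) (VectorField.mlieBracket (𝓡 7) P Q x) (R x)
        = - dirDeriv (fun y => η y (VectorField.mlieBracket (𝓡 7) P Q y)) x (R x)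
          - η x (VectorField.mlieBracket (𝓡 7) (VectorField.mlieBracket (𝓡 7) P Q) R x) := by
    intro P Q R d hP hQ hR hd
    rw [extDerivHom_apply _ hV hx (hP.mlieBracket hQ hV) hR, extDerivFields,
      dirDeriv_eq_zero hV hx _ hd]
    ring
  have hfun : ∀ {P Q : (x : M) → TangentSpace (𝓡 7) x} {d e : ℝ} (v : TangentSpace (𝓡 7) x),
      (∀ y ∈ V, η y (P y) = d) → (∀ y ∈ V, η y (Q y) = e) →
      dirDeriv (fun y => extDerivFields η P Q y) x v
        = - dirDeriv (fun y => η y (VectorField.mlieBracket (𝓡 7) P Q y)) x v := by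
    intro P Q d e v hd he
    rw [dirDeriv_congr hV hx (fun y hy => extDerivFields_of_const hV hy d e hd he), dirDeriv,
      mvfderiv_fun_neg]
    rfl
  rw [hbr hX hY hZ hηZ, hbr hY hZ hX hηX, hbr hZ hX hY hηY, hfun _ hηY hηZ, hfun _ hηZ hηX,
    hfun _ hηX hηY]
  have : IsManifold (𝓡 7) (minSmoothness ℝ 3) M := by
    simpa using (inferInstance : IsManifold (𝓡 7) 3 M)
  have hs : ∀ {P : (x : M) → TangentSpace (𝓡 7) x}, SmoothField P V →
      ContMDiffAt (𝓡 7) (𝓡 7).tangent (minSmoothness ℝ 2)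
        (fun x => (⟨x, P x⟩ : TangentBundle (𝓡 7) M)) x := fun hP =>
    (hP.contMDiffAt hV hx).of_le (by simpa using ENat.LEInfty.out)
  have hJ := congrArg (η x) (leibniz_identity_mlieBracket_apply (hs hX) (hs hY) (hs hZ))
  rw [mlieBracket_swap_apply, mlieBracket_swap_apply (V := Y), map_add, map_neg, map_neg] at hJ
  have h2 : VectorField.mlieBracket (𝓡 7) (VectorField.mlieBracket (𝓡 7) Z X) Y x
      = - VectorField.mlieBracket (𝓡 7) (VectorField.mlieBracket (𝓡 7) X Z) Y x := by
    have : VectorField.mlieBracket (𝓡 7) Z X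
        = (fun _ : M => (-1 : ℝ)) • VectorField.mlieBracket (𝓡 7) X Z := by
      rw [mlieBracket_swap]; ext; simp
    rw [this, mlieBracket_smul_left mdifferentiableAt_const
      ((hX.mlieBracket hZ hV).mdifferentiableAt hV hx)]
    simp [mvfderiv_const]
  rw [h2, map_neg]
  linarith

/-- A section of a bundle spanned by a smooth frame `s` is smooth as soon as the numbers
`h j = ∑ i, c i * A i j` are, where `c` are its coordinates and `A` is a smooth invertible
matrix. -/
theorem smoothField_of_gram {k : ℕ} {s : Fin k → (x : M) → TangentSpace (𝓡 7) x}
    (hs : ∀ i, SmoothField (s i) V) {A : M → Matrix (Fin k) (Fin k) ℝ} {h : Fin k → M → ℝ}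
    (hA : ∀ i j, ContMDiffOn (𝓡 7) 𝓘(ℝ, ℝ) ∞ (fun y => A y i j) V)
    (hh : ∀ j, ContMDiffOn (𝓡 7) 𝓘(ℝ, ℝ) ∞ (h j) V) (hdet : ∀ y ∈ V, IsUnit (A y).det)
    (hZ : ∀ y ∈ V, ∃ c : Fin k → ℝ, Z y = ∑ i, c i • s i y ∧ ∀ j, h j y = ∑ i, c i * A y i j) :
    SmoothField Z V := by
  have hdets : ContMDiffOn (𝓡 7) 𝓘(ℝ, ℝ) ∞ (fun y => (A y).det) V := by
    simp only [Matrix.det_apply']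
    refine contMDiffOn_finsetSum fun σ _ => ?_
    refine contMDiffOn_const.mul ?_
    exact contMDiffOn_finsetProd fun i _ => hA _ _
  have hadj : ∀ i j, ContMDiffOn (𝓡 7) 𝓘(ℝ, ℝ) ∞ (fun y => (A y).adjugate i j) V := by
    intro i j
    simp only [Matrix.adjugate_apply, Matrix.det_apply']
    refine contMDiffOn_finsetSum fun σ _ => ?_
    refine contMDiffOn_const.mul ?_
    refine contMDiffOn_finsetProd fun l _ => ?_
    by_cases hl : σ l = j
    · simp only [hl, Matrix.updateRow_self]; exact contMDiffOn_const
    · simp only [Matrix.updateRow_ne hl]; exact hA _ _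
  have hinv : ContMDiffOn (𝓡 7) 𝓘(ℝ, ℝ) ∞ (fun y => ((A y).det)⁻¹) V :=
    fun y hy => (hdets y hy).inv₀ (hdet y hy).ne_zero
  -- the coordinates are `h A⁻¹`, and the entries of `A⁻¹` are smooth by Cramer's rule
  refine (SmoothField.sum
    (X := fun i y => (∑ j, h j y * (((A y).det)⁻¹ * (A y).adjugate j i)) • s i y)
    fun i => SmoothField.smul ?_ (hs i)).congr fun y hy => ?_
  · exact contMDiffOn_finsetSum fun j _ => (hh j).mul (hinv.mul (hadj j i))
  · obtain ⟨c, hc, hj⟩ := hZ y hy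
    rw [hc]
    refine Finset.sum_congr rfl fun i _ => ?_
    congr 1
    have h1 : Matrix.vecMul (fun j => h j y) (A y)⁻¹ = c := by
      have : (fun j => h j y) = Matrix.vecMul c (A y) := by
        ext j; rw [hj]; rfl
      rw [this, Matrix.vecMul_vecMul, Matrix.mul_nonsing_inv _ (hdet y hy), Matrix.vecMul_one]
    have h2 := congrFun h1 i
    simp only [Matrix.vecMul, dotProduct, Matrix.inv_def, Matrix.smul_apply, smul_eq_mul,
      Ring.inverse_eq_inv'] at h2
    exact h2.symm

/-- The extension of a tangent vector is smooth on the domain of the chosen trivialization. -/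
theorem smoothField_extend (v : TangentSpace (𝓡 7) x) :
    SmoothField (FiberBundle.extend E7 v)
      (trivializationAt E7 (TangentSpace (𝓡 7) : M → Type _) x).baseSet := by
  set t := trivializationAt E7 (TangentSpace (𝓡 7) : M → Type _) x with ht
  intro y hy
  rw [t.contMDiffWithinAt_section _ hy]
  have : ContMDiffOn (𝓡 7) 𝓘(ℝ, E7) ∞ (fun _ : M => (t ⟨x, v⟩).2) t.baseSet := contMDiffOn_const
  refine (this y hy).congr (fun z hz => ?_) ?_
  · simp [FiberBundle.extend, ← ht, hz]
  · simp [FiberBundle.extend, ← ht, hy]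

end Calculus

/-! ### Quaternionic linear algebra in dimension four -/

section Hyperhermitian

variable {V : Type*} [AddCommGroup V] [Module ℝ V]

/-- A Euclidean metric together with a quaternionic structure by skew endomorphisms. -/
structure IsHyperhermitian (g : LinearMap.BilinForm ℝ V) (J : Fin 3 → V →ₗ[ℝ] V) : Prop where
  symm : ∀ v w, g v w = g w v
  pos : ∀ v, v ≠ 0 → 0 < g v v
  quaternionic : IsQuaternionic J
  skew : ∀ i v w, g (J i v) w = - g v (J i w)

namespace IsHyperhermitian

variable {g : LinearMap.BilinForm ℝ V} {J : Fin 3 → V →ₗ[ℝ] V} (hJ : IsHyperhermitian g J)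

include hJ

theorem eq_of_pairing {v w : V} (h : ∀ z, g v z = g w z) : v = w := by
  by_contra hne
  have h1 := hJ.pos (v - w) (sub_ne_zero.mpr hne)
  have h2 := h (v - w)
  rw [map_sub g, LinearMap.sub_apply, h2, sub_self] at h1
  exact lt_irrefl _ h1

theorem sq (i : Fin 3) (v : V) : J i (J i v) = -v := hJ.quaternionic.1 i v

theorem J01 (v : V) : J 0 (J 1 v) = J 2 v := hJ.quaternionic.2.1 v

theorem J10 (v : V) : J 1 (J 0 v) = - J 2 v := hJ.quaternionic.2.2 v

theorem J12 (v : V) : J 1 (J 2 v) = J 0 v := by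
  have h := hJ.J10 (J 1 v)
  rw [hJ.J01, ← hJ.J01 (J 1 v), hJ.sq, map_neg, neg_neg] at h
  exact h

theorem J20 (v : V) : J 2 (J 0 v) = J 1 v := by
  have h := hJ.J10 (J 0 v)
  rw [hJ.sq, map_neg] at h
  exact (neg_injective h).symm

theorem J21 (v : V) : J 2 (J 1 v) = - J 0 v := by rw [← hJ.J01, hJ.sq, map_neg]

theorem J02 (v : V) : J 0 (J 2 v) = - J 1 v := by rw [← hJ.J01, hJ.sq]

theorem mul_succ (i : Fin 3) (v : V) : J i (J (i + 1) v) = J (i + 2) v := by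
  fin_cases i
  · exact hJ.J01 v
  · exact hJ.J12 v
  · exact hJ.J20 v

theorem clifford (i j : Fin 3) (v : V) :
    J i (J j v) + J j (J i v) = (if i = j then (-2 : ℝ) else 0) • v := by
  fin_cases i <;> fin_cases j <;>
    simp [hJ.sq, hJ.J01, hJ.J10, hJ.J12, hJ.J20, hJ.J21, hJ.J02] <;> module

theorem J_self (i : Fin 3) (v : V) : g (J i v) v = 0 := by
  have h := hJ.skew i v v
  rw [hJ.symm v] at h
  linarith

theorem self_J (i : Fin 3) (v : V) : g v (J i v) = 0 := by
  rw [hJ.symm, hJ.J_self]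

theorem J_J (i j : Fin 3) (v : V) : g (J i v) (J j v) = if i = j then g v v else 0 := by
  fin_cases i <;> fin_cases j <;>
    simp [hJ.skew, hJ.sq, hJ.J01, hJ.J10, hJ.J12, hJ.J20, hJ.J21, hJ.J02, hJ.self_J]

theorem eq_zero_of_orthogonal (h4 : Module.finrank ℝ V = 4) {u z : V} (hu : g u u = 1)
    (h0 : g z u = 0) (hi : ∀ i, g z (J i u) = 0) : z = 0 := by
  have horth : ∀ a b : Fin 4, g ((![u, J 0 u, J 1 u, J 2 u] : Fin 4 → V) a)
      ((![u, J 0 u, J 1 u, J 2 u] : Fin 4 → V) b) = if a = b then 1 else 0 := by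
    intro a b
    fin_cases a <;> fin_cases b <;> simp [hu, hJ.J_self, hJ.self_J, hJ.J_J]
  have hli : LinearIndependent ℝ (![u, J 0 u, J 1 u, J 2 u] : Fin 4 → V) := by
    rw [Fintype.linearIndependent_iff]
    intro c hc b
    have := congrArg (fun v => g v ((![u, J 0 u, J 1 u, J 2 u] : Fin 4 → V) b)) hc
    simp only [map_sum, LinearMap.sum_apply, map_smul, LinearMap.smul_apply, horth] at this
    simpa using this
  have hspan := hli.span_eq_top_of_card_eq_finrank (by simp [h4])
  refine hJ.eq_of_pairing fun w => ?_
  have hw : w ∈ Submodule.span ℝ (Set.range (![u, J 0 u, J 1 u, J 2 u] : Fin 4 → V)) := by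
    rw [hspan]; trivial
  rw [map_zero, LinearMap.zero_apply]
  induction hw using Submodule.span_induction with
  | mem w hw =>
    obtain ⟨a, rfl⟩ := hw
    fin_cases a
    exacts [h0, hi 0, hi 1, hi 2]
  | zero => simp
  | add v w _ _ hv hw => simp [hv, hw]
  | smul c v _ hv => simp [hv]

/-- The expansion in the orthonormal basis `(u, I₁u, I₂u, I₃u)`. -/
theorem expand (h4 : Module.finrank ℝ V = 4) {u : V} (hu : g u u = 1) (v : V) :
    v = g v u • u + ∑ k, g v (J k u) • J k u := by
  rw [← sub_eq_zero]
  refine hJ.eq_zero_of_orthogonal h4 hu ?_ fun i => ?_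
  · simp [hu, hJ.J_self]
  · simp [hJ.self_J, hJ.J_J, hu]

theorem exists_unit (h4 : Module.finrank ℝ V = 4) : ∃ u, g u u = 1 := by
  have : Nontrivial V := Module.nontrivial_of_finrank_pos (R := ℝ) (by omega)
  obtain ⟨v, hv⟩ := exists_ne (0 : V)
  have hp := hJ.pos v hv
  refine ⟨(Real.sqrt (g v v))⁻¹ • v, ?_⟩
  have hs := Real.mul_self_sqrt hp.le
  have hs' : Real.sqrt (g v v) ≠ 0 := (Real.sqrt_pos.mpr hp).ne'
  simp only [map_smul, LinearMap.smul_apply, smul_eq_mul]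
  field_simp
  rw [pow_two]; exact hs.symm

/-- Skew maps `q_i` which anticommute with `I_i` and vanish at a unit vector `u` are zero: in the
basis `(u, I₁u, I₂u, I₃u)` the only entry of `q_i` that could survive is the one between
`I_j u` and `I_k u`, with `i, j, k` distinct. It is antisymmetric, and symmetric by
anticommutation. -/
theorem derivation_eq_zero (h4 : Module.finrank ℝ V = 4) {u : V} (hu : g u u = 1)
    {q : Fin 3 → V → V} (hskew : ∀ i a b, g (q i a) b = - g a (q i b))
    (hq : ∀ i a, q i (J i a) = - J i (q i a)) (hu0 : ∀ i, q i u = 0) (i : Fin 3) (a : V) :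
    q i a = 0 := by
  have h1 : ∀ i, q i (J i u) = 0 := fun i => by rw [hq, hu0, map_zero, neg_zero]
  have h2 : ∀ i, g (q i (J (i + 1) u)) (J (i + 2) u) = 0 := by
    intro i
    have h := hq i (J (i + 1) u)
    rw [hJ.mul_succ] at h
    have h' := congrArg (fun z => g z (J (i + 1) u)) h
    simp only [map_neg, LinearMap.neg_apply, hJ.skew, hJ.mul_succ] at h'
    rw [hskew, hJ.symm] at h'
    linarith
  have h3 : ∀ i k, q i (J k u) = 0 := by
    intro i k
    refine hJ.eq_zero_of_orthogonal h4 hu ?_ fun l => ?_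
    · rw [hskew, hu0, map_zero, neg_zero]
    · have hself : ∀ z, g (q i z) z = 0 := fun z => by
        have := hskew i z z
        rw [hJ.symm z] at this
        linarith
      have ha := h2 i
      have hb : g (q i (J (i + 2) u)) (J (i + 1) u) = 0 := by
        rw [hskew, hJ.symm, ha, neg_zero]
      have hc : ∀ k, g (q i (J k u)) (J i u) = 0 := fun k => by
        rw [hskew, h1, map_zero, neg_zero]
      have hd : ∀ k, g (q i (J i u)) (J k u) = 0 := fun k => by
        rw [h1, map_zero, LinearMap.zero_apply]
      fin_cases i <;> fin_cases k <;> fin_cases l <;>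
        first | exact hself _ | exact hc _ | exact hd _ | exact ha | exact hb
  refine hJ.eq_of_pairing fun b => ?_
  rw [hskew, hJ.expand h4 hu a]
  simp only [map_add, map_sum, map_smul, LinearMap.add_apply, LinearMap.sum_apply,
    LinearMap.smul_apply, smul_eq_mul]
  have h5 : g u (q i b) = 0 := by
    have := hskew i u b
    rw [hu0, map_zero, LinearMap.zero_apply] at this
    linarith
  have h6 : ∀ k, g (J k u) (q i b) = 0 := fun k => by
    have := hskew i (J k u) b
    rw [h3, map_zero, LinearMap.zero_apply] at this
    linarith
  simp [h5, h6]

/-- An infinitesimal deformation `p` of the quaternionic structure by skew endomorphisms is a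
rotation of `(I₁, I₂, I₃)`; its coefficients can be read at any unit vector `u`. -/
theorem derivation_eq (h4 : Module.finrank ℝ V = 4) {u : V} (hu : g u u = 1)
    {p : Fin 3 → V → V} (hskew : ∀ i a b, g (p i a) b = - g a (p i b))
    (hp : ∀ j k a, p j (J k a) + J j (p k a) + p k (J j a) + J k (p j a) = 0) :
    (∀ j k, g (p j u) (J k u) = - g (p k u) (J j u)) ∧
      ∀ j a, p j a = ∑ k, g (p j u) (J k u) • J k a := by
  have hanti : ∀ j k, g (p j u) (J k u) = - g (p k u) (J j u) := by
    intro j k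
    have h := congrArg (fun z => g z u) (hp j k u)
    simp only [map_add, LinearMap.add_apply, map_zero, LinearMap.zero_apply, hJ.skew] at h
    rw [hskew, hskew k (J j u), hJ.symm (J k u), hJ.symm (J j u)] at h
    linarith
  refine ⟨hanti, fun j a => ?_⟩
  rw [← sub_eq_zero]
  have hself : ∀ i z, g (p i z) z = 0 := fun i z => by
    have := hskew i z z
    rw [hJ.symm z] at this
    linarith
  refine hJ.derivation_eq_zero h4 hu
    (q := fun j a => p j a - ∑ k, g (p j u) (J k u) • J k a) ?_ ?_ ?_ j a
  · intro i a b
    simp only [map_sub, map_sum, map_smul, LinearMap.sub_apply, LinearMap.sum_apply,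
      LinearMap.smul_apply, hskew i a b, hJ.skew _ a b]
    simp [Finset.sum_neg_distrib]
    ring
  · intro i a
    have h1 := hp i i a
    have h2 : p i (J i a) = - J i (p i a) := by
      have : (2 : ℝ) • (p i (J i a) + J i (p i a)) = 0 := by
        rw [← h1]; module
      rw [smul_eq_zero_iff_right two_ne_zero] at this
      exact eq_neg_of_add_eq_zero_left this
    have h3 : ∑ k, g (p i u) (J k u) • J k (J i a)
        = - ∑ k, g (p i u) (J k u) • J i (J k a) := by
      rw [eq_neg_iff_add_eq_zero, ← Finset.sum_add_distrib]
      simp only [← smul_add, hJ.clifford]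
      refine Finset.sum_eq_zero fun k _ => ?_
      split_ifs with h
      · subst h
        have : g (p k u) (J k u) = 0 := by linarith [hanti k k]
        rw [this, zero_smul]
      · simp
    simp only [map_sub, map_sum, map_smul, h2, h3]
    abel
  · intro i
    have := hJ.expand h4 hu (p i u)
    rw [hself, zero_smul, zero_add] at this
    exact sub_eq_zero.mpr this

/-- `∑ γ_k ∧ w_k = 0` implies `∑ I_k γ_k = 0`. The identity is evaluated at `I₁u, I₂u, I₃u`. -/
theorem sum_apply_J_eq_zero {γ : Fin 3 → V → ℝ} (hγ0 : ∀ k, γ k 0 = 0)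
    (h : ∀ X Y Z, ∑ k, (γ k X * g (J k Y) Z + γ k Y * g (J k Z) X + γ k Z * g (J k X) Y) = 0)
    (u : V) : ∑ k, γ k (J k u) = 0 := by
  by_cases hu : u = 0
  · simp [hu, hγ0]
  · have h1 := h (J 0 u) (J 1 u) (J 2 u)
    simp [Fin.sum_univ_three, hJ.sq, hJ.J01, hJ.J10, hJ.J12, hJ.J20, hJ.J21, hJ.J02, hJ.self_J,
      hJ.J_J] at h1
    have h2 := hJ.pos u hu
    have h3 : (γ 0 (J 0 u) + γ 1 (J 1 u) + γ 2 (J 2 u)) * g u u = 0 := by linarith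
    rw [Fin.sum_univ_three]
    exact (mul_eq_zero.mp h3).resolve_right h2.ne'

/-- An antisymmetric family of covectors with `∑ I_k β_{jk} = 0` for all `j` vanishes. -/
theorem antisymm_eq_zero {β : Fin 3 → Fin 3 → V → ℝ} (hodd : ∀ j k v, β j k (-v) = - β j k v)
    (hanti : ∀ j k v, β j k v = - β k j v) (h : ∀ j u, ∑ k, β j k (J k u) = 0)
    (j k : Fin 3) (v : V) : β j k v = 0 := by
  have hd : ∀ j v, β j j v = 0 := fun j v => by linarith [hanti j j v]
  simp only [Fin.sum_univ_three] at h
  have h01 : ∀ v, β 0 1 (J 1 v) = 0 := by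
    intro v
    have e0 := h 0 v
    have e1 := h 1 (J 2 v)
    have e2 := h 2 (J 1 v)
    simp only [hd, hJ.sq, hJ.J02, hJ.J01, hJ.J21, hJ.J12, hodd, hanti 1 0,
      hanti 2 0, hanti 2 1] at e0 e1 e2
    linarith
  have h01' : ∀ v, β 0 1 v = 0 := fun v => by
    have := h01 (-J 1 v)
    rwa [map_neg, hJ.sq, neg_neg] at this
  have h02' : ∀ v, β 0 2 v = 0 := fun v => by
    have := h 0 (-J 2 v)
    simpa [hd, h01', hJ.sq] using this
  have h12' : ∀ v, β 1 2 v = 0 := fun v => by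
    have := h 1 (-J 2 v)
    simpa [hd, hanti 1 0, h01', hJ.sq] using this
  fin_cases j <;> fin_cases k <;>
    simp [hd, h01', h02', h12', hanti 1 0, hanti 2 0, hanti 2 1]

theorem tensorOfCoeff_injective (h4 : Module.finrank ℝ V = 4) {c c' : Fin 3 → Fin 3 → V → ℝ}
    (h : tensorOfCoeff g J c = tensorOfCoeff g J c') : c = c' := by
  obtain ⟨u, hu⟩ := hJ.exists_unit h4
  ext i j X
  have := congrFun h ![X, u, J i u, u, J j u]
  simpa [tensorOfCoeff, hJ.J_J, hu] using this

/-- The relation `∑ I_i a_{ij} = 0` forces the trace of `a` to vanish: apply `I_j` and sum. -/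
theorem trace_eq_zero {a : Fin 3 → Fin 3 → V} (hsymm : ∀ i j, a i j = a j i)
    (h : ∀ j, ∑ i, J i (a i j) = 0) : ∑ i, a i i = 0 := by
  simp only [Fin.sum_univ_three] at h ⊢
  have e0 := congrArg (J 0) (h 0)
  have e1 := congrArg (J 1) (h 1)
  have e2 := congrArg (J 2) (h 2)
  simp only [map_add, map_zero, hJ.sq, hJ.J01, hJ.J10, hJ.J12, hJ.J20, hJ.J21, hJ.J02,
    hsymm 1 0, hsymm 2 0, hsymm 2 1] at e0 e1 e2
  have := congrArg₂ (· + ·) (congrArg₂ (· + ·) e0 e1) e2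
  simp only [add_zero] at this
  rw [← neg_eq_zero, ← this]
  abel

theorem memDualS40 {τ : (Fin 5 → V) → ℝ} (h : MemS51 g J τ) : MemDualS40 g J τ := by
  obtain ⟨a, hsymm, ha, rfl⟩ := h
  refine ⟨fun i j => g (a i j), fun i j => congrArg g (hsymm i j), ?_, rfl⟩
  rw [← map_sum, hJ.trace_eq_zero hsymm ha, map_zero]

end IsHyperhermitian

/-! ### Traces in an orthonormal basis -/

variable {g : LinearMap.BilinForm ℝ V} {J : Fin 3 → V →ₗ[ℝ] V} {e : Module.Basis (Fin 4) ℝ V}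

theorem IsOrthonormal.expand (he : IsOrthonormal g e) (v : V) : ∑ a, g v (e a) • e a = v := by
  conv_rhs => rw [← e.sum_repr v]
  refine Finset.sum_congr rfl fun a _ => ?_
  congr 1
  conv_lhs => rw [← e.sum_repr v]
  simp only [map_sum, map_smul, LinearMap.sum_apply, LinearMap.smul_apply, he _ a]
  simp

theorem IsOrthonormal.sum_pairing (he : IsOrthonormal g e) (v w : V) :
    ∑ a, g v (e a) * g (e a) w = g v w := by
  conv_rhs => rw [← he.expand v]
  simp

theorem IsOrthonormal.sum_adjoint (he : IsOrthonormal g e) (hs : ∀ v w, g v w = g w v)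
    {A A' B B' : V → V} (hA : ∀ v w, g (A v) w = g v (A' w))
    (hB : ∀ v w, g (B v) w = g v (B' w)) :
    ∑ a, g (A (e a)) (B (e a)) = ∑ a, g (A' (e a)) (B' (e a)) := by
  rw [Finset.sum_congr rfl fun a _ => (he.sum_pairing (A (e a)) (B (e a))).symm,
    Finset.sum_congr rfl fun a _ => (he.sum_pairing (A' (e a)) (B' (e a))).symm, Finset.sum_comm]
  refine Finset.sum_congr rfl fun a _ => Finset.sum_congr rfl fun b _ => ?_
  rw [hA, hs (e a) (B _), hB, hs (e b) (A' _), hs (A' _)]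

/-- For `S` symmetric, the selfdual part of `w_j(S·,·) + w_j(·,S·)` is a multiple of `w_j`, with a
factor independent of `j`. -/
theorem IsHyperhermitian.sum_symm (hJ : IsHyperhermitian g J) (he : IsOrthonormal g e)
    {S : V → V} (hS : ∀ v w, g (S v) w = g v (S w)) (j k : Fin 3) :
    ∑ a, (g (J j (S (e a))) (J k (e a)) + g (J j (e a)) (S (J k (e a))))
      = if j = k then 2 * ∑ a, g (S (e a)) (e a) else 0 := by
  have h1 : ∑ a, g (J j (e a)) (S (J k (e a))) = ∑ a, g (J j (S (e a))) (J k (e a)) := by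
    have := he.sum_adjoint hJ.symm (A := fun v => S (J j v)) (B := J k)
      (A' := fun v => - J j (S v)) (B' := fun v => - J k v)
      (fun v w => by rw [hS, hJ.skew, map_neg]) (fun v w => by rw [hJ.skew, map_neg])
    simp only [map_neg, LinearMap.neg_apply, neg_neg, hS] at this
    exact this
  have h2 : ∀ m, ∑ a, g (S (e a)) (J m (e a)) = 0 := by
    intro m
    have := he.sum_adjoint hJ.symm (A := S) (B := J m) (A' := S) (B' := fun v => - J m v) hS
      (fun v w => by rw [hJ.skew, map_neg])
    simp only [map_neg, Finset.sum_neg_distrib] at this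
    linarith
  rw [Finset.sum_add_distrib, h1]
  simp only [hJ.skew]
  fin_cases j <;> fin_cases k <;>
    simp [hJ.sq, hJ.J01, hJ.J10, hJ.J12, hJ.J20, hJ.J21, hJ.J02, h2] <;> ring

theorem IsHyperhermitian.selfDualCoeff_eq (hJ : IsHyperhermitian g J) (he : IsOrthonormal g e)
    {D : V → V → (Fin 4 → V) → ℝ} {d : Fin 3 → Fin 3 → V → V → ℝ}
    (hD : ∀ X Y Z, D X Y Z = ∑ l, ∑ m, d l m X Y * g (J l (Z 0)) (Z 1) * g (J m (Z 2)) (Z 3))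
    (k i j : Fin 3) :
    selfDualCoeff J e D k i j = (1 / 4) * ∑ a, d i j (e a) (J k (e a)) := by
  have h : ∀ a b c, D (e a) (J k (e a)) ![e b, J i (e b), e c, J j (e c)]
      = d i j (e a) (J k (e a)) := by
    intro a b c
    rw [hD]
    simp [hJ.J_J, he _ _]
  simp only [selfDualCoeff, h, Finset.sum_const, Finset.card_univ, Fintype.card_fin, nsmul_eq_mul,
    ← Finset.mul_sum]
  push_cast
  ring

end Hyperhermitian

/-- The symmetrisation of `t ⊗ δ` has no component in `S^{6,0}`. -/
theorem projS60_eq_zero {C : Fin 3 → Fin 3 → Fin 3 → ℝ} {t : Fin 3 → ℝ}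
    (h : ∀ i j k, sym3 C i j k = (if j = k then t i else 0) + (if i = k then t j else 0)
      + (if i = j then t k else 0)) : projS60 C = 0 := by
  ext i j k
  simp only [projS60, h, Fin.sum_univ_three]
  fin_cases i <;> fin_cases j <;> fin_cases k <;> simp <;> ring

/-! ### Adapted frames -/

section Frames

variable {M : Type*} [TopologicalSpace M] [ChartedSpace E7 M] [IsManifold (𝓡 7) ∞ M]
  {Q : QCStructure M} {g : CompatibleMetric Q} {W : Complement Q} {U V : Set M} {x : M}

theorem QCStructure.finrank_fiber (Q : QCStructure M) (x : M) :
    Module.finrank ℝ (Q.fiber x) = 4 := by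
  obtain ⟨U, -, hx, s, -, hs⟩ := Q.smooth x
  obtain ⟨b, -⟩ := hs x hx
  simpa using Module.finrank_eq_card_basis b

theorem Complement.finrank_fiber (W : Complement Q) (x : M) :
    Module.finrank ℝ (W.fiber x) = 3 := by
  obtain ⟨U, -, hx, s, -, hs⟩ := W.smooth x
  obtain ⟨hli, hspan⟩ := hs x hx
  rw [← hspan, finrank_span_eq_card hli]
  simp

theorem Complement.projH_add_projW (W : Complement Q) (x : M) (v : TangentSpace (𝓡 7) x) :
    (W.projH x v : TangentSpace (𝓡 7) x) + W.projW x v = v :=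
  Submodule.projection_add_projection_eq_self (W.isCompl x) v

theorem Complement.projH_coe (W : Complement Q) (x : M) (v : Q.fiber x) :
    W.projH x (v : TangentSpace (𝓡 7) x) = v :=
  Submodule.projectionOnto_apply_left (W.isCompl x) v

theorem Complement.projH_of_mem (W : Complement Q) (x : M) {v : TangentSpace (𝓡 7) x}
    (hv : v ∈ Q.fiber x) : (W.projH x v : TangentSpace (𝓡 7) x) = v :=
  congrArg Subtype.val (W.projH_coe x ⟨v, hv⟩)

theorem Complement.projH_of_mem_fiber (W : Complement Q) (x : M) {v : TangentSpace (𝓡 7) x}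
    (hv : v ∈ W.fiber x) : W.projH x v = 0 :=
  Submodule.projectionOnto_apply_right (W.isCompl x) ⟨v, hv⟩

namespace AdaptedFrame

variable (F : AdaptedFrame g W U)

/-- The complex structures are skew because `g(I_i ·, ·)` is the restriction of `dη_i`. -/
theorem hyperhermitian (hx : x ∈ U) : IsHyperhermitian (g.form x) (fun i => F.J i x) where
  symm := g.symm x
  pos := g.pos x
  quaternionic := F.quaternionic x hx
  skew i v w := by
    rw [← F.extDeriv_eq i x hx, g.symm x v, ← F.extDeriv_eq i x hx]
    exact extDerivFields_swap x

theorem sum_eta_smul_R (hx : x ∈ U) (r : W.fiber x) : ∑ k, F.η k x r • F.R k x = r := by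
  have hd : ∀ (c : Fin 3 → ℝ) j, F.η j x (∑ k, c k • F.R k x : W.fiber x) = c j := by
    intro c j
    simp [F.dual _ j x hx]
  have hli : LinearIndependent ℝ (fun k => F.R k x) := by
    rw [Fintype.linearIndependent_iff]
    intro c hc j
    rw [← hd c j, hc]
    simp
  have hspan := hli.span_eq_top_of_card_eq_finrank (by simp [W.finrank_fiber x])
  have hr : r ∈ Submodule.span ℝ (Set.range fun k => F.R k x) := by rw [hspan]; trivial
  obtain ⟨c, rfl⟩ := (Submodule.mem_span_range_iff_exists_fun ℝ).mp hr
  simp only [hd]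

theorem eta_projW (hx : x ∈ U) (j : Fin 3) (v : TangentSpace (𝓡 7) x) :
    F.η j x (W.projW x v) = F.η j x v := by
  conv_rhs => rw [← W.projH_add_projW x v, map_add, F.vanish j x hx _ (W.projH x v).2, zero_add]

theorem decomp (hx : x ∈ U) (v : TangentSpace (𝓡 7) x) :
    v = (W.projH x v : TangentSpace (𝓡 7) x)
      + ∑ k, F.η k x v • (F.R k x : TangentSpace (𝓡 7) x) := by
  have h := congrArg Subtype.val (F.sum_eta_smul_R hx (W.projW x v))
  simp only [F.eta_projW hx] at h
  conv_lhs => rw [← W.projH_add_projW x v, ← h]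
  simp

theorem metricW_R_right (hx : x ∈ U) (r : W.fiber x) (j : Fin 3) :
    F.metricW x r (F.R j x) = F.η j x r := by
  simp [metricW, F.dual j _ x hx]

theorem metricW_comm (r s : W.fiber x) : F.metricW x r s = F.metricW x s r := by
  simp only [metricW, mul_comm]

/-- The smoothness of `R_i` is not part of the definition of a frame: it follows from that of `W`
and of the forms `η_j`, to which `(R_i)` is dual. -/
theorem smoothSection_R (i : Fin 3) : SmoothSection (fun y => F.R i y) U := by
  intro x hx
  obtain ⟨U', hU', hxU', s, hs, hspan⟩ := W.smooth x
  have hV : IsOpen (U ∩ U') := F.isOpen.inter hU'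
  have key : SmoothField (fun y => (F.R i y : TangentSpace (𝓡 7) y)) (U ∩ U') := by
    refine smoothField_of_gram (s := s) (A := fun y => Matrix.of fun a b => F.η b y (s a y))
      (h := fun j _ => if i = j then 1 else 0) (fun a => (hs a).mono Set.inter_subset_right)
      (fun a b => ((F.smooth b).mono Set.inter_subset_left).contMDiffOn_apply
        ((hs a).mono Set.inter_subset_right))
      (fun _ => contMDiffOn_const) ?_ ?_
    · intro y hy
      rw [isUnit_iff_ne_zero, Ne, ← Matrix.exists_vecMul_eq_zero_iff]
      rintro ⟨c, hc0, hc⟩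
      have hmem : ∑ a, c a • s a y ∈ W.fiber y := by
        rw [← (hspan y hy.2).2]
        exact Submodule.sum_mem _ fun a _ =>
          Submodule.smul_mem _ _ (Submodule.subset_span ⟨a, rfl⟩)
      have hzero : ∀ k, F.η k y (∑ a, c a • s a y) = 0 := by
        intro k
        have := congrFun hc k
        simpa [Matrix.vecMul, dotProduct] using this
      have h := F.sum_eta_smul_R hy.1 ⟨_, hmem⟩
      simp only [hzero, zero_smul, Finset.sum_const_zero] at h
      have h' : ∑ a, c a • s a y = 0 := (congrArg Subtype.val h).symm
      exact hc0 (funext (Fintype.linearIndependent_iff.mp (hspan y hy.2).1 c h'))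
    · intro y hy
      have hmem : (F.R i y : TangentSpace (𝓡 7) y) ∈
          Submodule.span ℝ (Set.range fun a => s a y) := by
        rw [(hspan y hy.2).2]; exact (F.R i y).2
      obtain ⟨c, hc⟩ := (Submodule.mem_span_range_iff_exists_fun ℝ).mp hmem
      refine ⟨c, hc.symm, fun j => ?_⟩
      rw [← F.dual i j y hy.1, ← hc]
      simp
  exact (key.contMDiffAt hV ⟨hx, hxU'⟩).contMDiffWithinAt

theorem smoothSection_projH (F : AdaptedFrame g W U) (hVU : V ⊆ U)
    {X : (x : M) → TangentSpace (𝓡 7) x}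
    (hX : SmoothField X V) : SmoothSection (fun y => W.projH y (X y)) V := by
  have h : SmoothField (X - fun y => ∑ k, F.η k y (X y) • (F.R k y : TangentSpace (𝓡 7) y)) V :=
    hX.sub (SmoothField.sum fun k => SmoothField.smul
      (((F.smooth k).mono hVU).contMDiffOn_apply hX) (SmoothField.mono (F.smoothSection_R k) hVU))
  refine h.congr fun y hy => ?_
  exact eq_sub_of_add_eq (F.decomp (hVU hy) (X y)).symm

end AdaptedFrame
end Frames

/-! ### Sections of the distribution and the covariant derivative of the quaternionic structure -/

section Sections

variable {M : Type*} [TopologicalSpace M] [ChartedSpace E7 M] [IsManifold (𝓡 7) ∞ M]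
  {Q : QCStructure M} {g : CompatibleMetric Q} {W : Complement Q} {U V : Set M} {x : M}

theorem SmoothSection.mono {D : (x : M) → Submodule ℝ (TangentSpace (𝓡 7) x)} {X : (x : M) → D x}
    (hX : SmoothSection X U) (h : V ⊆ U) : SmoothSection X V :=
  SmoothField.mono hX h

namespace AdaptedFrame

variable (F : AdaptedFrame g W U)

/-- A neighbourhood of `x`, contained in the domain of the frame, on which the sections
`extendH W v` are smooth. -/
def nhd (_ : AdaptedFrame g W U) (x : M) : Set M :=
  U ∩ (trivializationAt E7 (TangentSpace (𝓡 7) : M → Type _) x).baseSet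

theorem isOpen_nhd (x : M) : IsOpen (F.nhd x) :=
  F.isOpen.inter (trivializationAt E7 (TangentSpace (𝓡 7) : M → Type _) x).open_baseSet

theorem mem_nhd (hx : x ∈ U) : x ∈ F.nhd x :=
  ⟨hx, FiberBundle.mem_baseSet_trivializationAt' x⟩

theorem nhd_subset (x : M) : F.nhd x ⊆ U := Set.inter_subset_left

theorem smoothSection_extendH (v : Q.fiber x) : SmoothSection (extendH W v) (F.nhd x) :=
  F.smoothSection_projH (F.nhd_subset x) ((smoothField_extend _).mono Set.inter_subset_right)

/-- On sections of `H` one has `dη_i(X, Y) = -η_i([X, Y])`. -/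
theorem form_J_apply (hV : IsOpen V) (hVU : V ⊆ U) (hx : x ∈ V) {X Y : (x : M) → Q.fiber x}
    (hX : SmoothSection X V) (hY : SmoothSection Y V) (i : Fin 3) :
    g.form x (F.J i x (X x)) (Y x) = - F.η i x (mlieBracket (𝓡 7)
      (fun y => (X y : TangentSpace (𝓡 7) y)) (fun y => (Y y : TangentSpace (𝓡 7) y)) x) := by
  rw [← F.extDeriv_eq i x (hVU hx), ← extDerivHom_eq (((F.smooth i).mono hVU).formMDiffAt hV hx),
    extDerivHom_apply _ hV hx hX hY]
  exact extDerivFields_of_const hV hx 0 0 (fun y hy => F.vanish i y (hVU hy) _ (X y).2)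
    (fun y hy => F.vanish i y (hVU hy) _ (Y y).2)

theorem contMDiffOn_form_J (hV : IsOpen V) (hVU : V ⊆ U) {X Y : (x : M) → Q.fiber x}
    (hX : SmoothSection X V) (hY : SmoothSection Y V) (i : Fin 3) :
    ContMDiffOn (𝓡 7) 𝓘(ℝ, ℝ) ∞ (fun y => g.form y (F.J i y (X y)) (Y y)) V :=
  (((F.smooth i).mono hVU).contMDiffOn_apply
    (SmoothField.mlieBracket hX hY hV)).neg.congr
    fun _ hy => F.form_J_apply hV hVU hy hX hY i

/-- The smoothness of `I_i` is not part of the definition of a frame: it follows from that of `g`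
and of `g(I_i ·, ·) = dη_i`. -/
theorem smoothSection_J (hV : IsOpen V) (hVU : V ⊆ U) {X : (x : M) → Q.fiber x}
    (hX : SmoothSection X V) (i : Fin 3) : SmoothSection (fun y => F.J i y (X y)) V := by
  intro x hx
  obtain ⟨U', hU', hxU', s, hs, hbasis⟩ := Q.smooth x
  have hV' : IsOpen (V ∩ U') := hV.inter hU'
  -- the frame `s`, as a family of sections of `H`
  let t : Fin 4 → (y : M) → Q.fiber y := fun a y => W.projH y (s a y)
  have ht : ∀ a, SmoothSection (t a) (V ∩ U') := fun a =>
    F.smoothSection_projH (Set.inter_subset_left.trans hVU) ((hs a).mono Set.inter_subset_right)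
  have key : SmoothField (fun y => (F.J i y (X y) : TangentSpace (𝓡 7) y)) (V ∩ U') := by
    refine smoothField_of_gram (s := fun a y => (t a y : TangentSpace (𝓡 7) y))
      (A := fun y => Matrix.of fun a b => g.form y (t a y) (t b y))
      (h := fun b y => g.form y (F.J i y (X y)) (t b y)) ht
      (fun a b => g.smooth _ _ _ hV' (ht a) (ht b))
      (fun b => F.contMDiffOn_form_J hV' (Set.inter_subset_left.trans hVU)
        (hX.mono Set.inter_subset_left) (ht b) i) ?_ ?_
    · intro y hy
      obtain ⟨b, hb, -⟩ := hbasis y hy.2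
      have htb : ∀ a, t a y = b a := fun a => by
        simp only [t, ← hb, W.projH_coe]
      rw [isUnit_iff_ne_zero, Ne, ← Matrix.exists_vecMul_eq_zero_iff]
      rintro ⟨c, hc0, hc⟩
      have hzero : ∀ k, g.form y (∑ a, c a • b a) (b k) = 0 := by
        intro k
        have := congrFun hc k
        simpa [Matrix.vecMul, dotProduct, htb] using this
      have hv : ∑ a, c a • b a = 0 := by
        by_contra hne
        have hp := g.pos y _ hne
        have : g.form y (∑ a, c a • b a) (∑ a, c a • b a) = 0 := by
          rw [map_sum]
          exact Finset.sum_eq_zero fun a _ => by rw [map_smul, hzero, smul_zero]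
        exact hp.ne' this
      exact hc0 (funext (Fintype.linearIndependent_iff.mp b.linearIndependent c hv))
    · intro y hy
      obtain ⟨b, hb, -⟩ := hbasis y hy.2
      have htb : ∀ a, t a y = b a := fun a => by
        simp only [t, ← hb, W.projH_coe]
      obtain ⟨c, hc⟩ : ∃ c : Fin 4 → ℝ, F.J i y (X y) = ∑ a, c a • b a :=
        ⟨_, (b.sum_repr _).symm⟩
      refine ⟨c, ?_, fun j => ?_⟩
      · rw [hc]
        simp [htb]
      · rw [hc]
        simp [htb]
  exact (key.contMDiffAt hV' ⟨hx, hxU'⟩).contMDiffWithinAt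

end AdaptedFrame

/-- The connection induced on `H`. -/
def covH (W : Complement Q) (cov : Connection M) (X : (y : M) → Q.fiber y) (x : M)
    (v : TangentSpace (𝓡 7) x) : Q.fiber x :=
  W.projH x (cov (fun y => (X y : TangentSpace (𝓡 7) y)) x v)

section Connection

variable {cov : Connection M} {X Y : (y : M) → Q.fiber y}

theorem covH_smul (X : (y : M) → Q.fiber y) (c : ℝ) (v : TangentSpace (𝓡 7) x) :
    covH W cov X x (c • v) = c • covH W cov X x v := by
  simp [covH]

/-- Linearity of the induced connection, for a linear relation between sections which is only
assumed near the point. -/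
theorem covH_add_eq_smul (hV : IsOpen V) (hx : x ∈ V) (hX : SmoothSection X V)
    (hY : SmoothSection Y V) {Z : (y : M) → Q.fiber y} (hZ : SmoothSection Z V) {c : ℝ}
    (h : ∀ y ∈ V, X y + Y y = c • Z y) (v : TangentSpace (𝓡 7) x) :
    covH W cov X x v + covH W cov Y x v = c • covH W cov Z x v := by
  have h1 := cov.isCovariantDerivativeOnUniv.add (SmoothField.mdifferentiableAt hX hV hx)
    (SmoothField.mdifferentiableAt hY hV hx)
  have h2 := cov.isCovariantDerivativeOnUniv.smul_const c
    (SmoothField.mdifferentiableAt hZ hV hx)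
  have h3 := (cov.isCovariantDerivativeOn (s := V)).congr_of_eqOn
    (σ := (fun y => (X y : TangentSpace (𝓡 7) y)) + fun y => (Y y : TangentSpace (𝓡 7) y))
    (σ' := c • fun y => (Z y : TangentSpace (𝓡 7) y)) (x := x)
    ((SmoothField.add hX hY).mdifferentiableAt hV hx)
    ((SmoothField.smul contMDiffOn_const hZ).mdifferentiableAt hV hx)
    (hV.mem_nhds hx) (fun y hy => congrArg Subtype.val (h y hy))
  have h4 := congrArg (fun A => W.projH x (A v)) (h1.symm.trans (h3.trans h2))
  simpa [covH] using h4

theorem dirDeriv_form (hcov : IsAssociatedConnection g W cov) (hV : IsOpen V) (hx : x ∈ V)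
    (hX : SmoothSection X V) (hY : SmoothSection Y V) (v : TangentSpace (𝓡 7) x) :
    dirDeriv (fun y => g.form y (X y) (Y y)) x v
      = g.form x (covH W cov X x v) (Y x) + g.form x (X x) (covH W cov Y x v) :=
  hcov.metric_H V X Y hV hX hY x hx v

theorem coe_covH (hcov : IsAssociatedConnection g W cov) (hV : IsOpen V) (hx : x ∈ V)
    (hX : SmoothSection X V) (v : TangentSpace (𝓡 7) x) :
    (covH W cov X x v : TangentSpace (𝓡 7) x)
      = cov (fun y => (X y : TangentSpace (𝓡 7) y)) x v :=
  W.projH_of_mem x (hcov.preserves_H V X hV hX x hx v)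

end Connection

namespace AdaptedFrame

variable (F : AdaptedFrame g W U) {cov : Connection M} {X Y : (y : M) → Q.fiber y}

/-- The covariant derivative `∇_v I_i` of the complex structure `I_i`. -/
def covJ (cov : Connection M) (i : Fin 3) (x : M) (v : TangentSpace (𝓡 7) x) (a : Q.fiber x) :
    Q.fiber x :=
  covH W cov (fun y => F.J i y (extendH W a y)) x v - F.J i x (covH W cov (extendH W a) x v)

theorem extendH_self (a : Q.fiber x) : extendH W a x = a := by
  simp [extendH, W.projH_coe]

/-- The derivative of the relation `g(I_i X, Y) = -g(X, I_i Y)`. -/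
theorem form_covH_J_skew (hcov : IsAssociatedConnection g W cov) (hV : IsOpen V) (hVU : V ⊆ U)
    (hx : x ∈ V) (hX : SmoothSection X V) (hY : SmoothSection Y V) (i : Fin 3)
    (v : TangentSpace (𝓡 7) x) :
    g.form x (covH W cov (fun y => F.J i y (X y)) x v - F.J i x (covH W cov X x v)) (Y x)
      = - g.form x (X x) (covH W cov (fun y => F.J i y (Y y)) x v
          - F.J i x (covH W cov Y x v)) := by
  have h1 := dirDeriv_form hcov hV hx (F.smoothSection_J hV hVU hX i) hY v
  have h2 := dirDeriv_form hcov hV hx hX (F.smoothSection_J hV hVU hY i) v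
  have h3 : dirDeriv (fun y => g.form y (F.J i y (X y)) (Y y)) x v
      = - dirDeriv (fun y => g.form y (X y) (F.J i y (Y y))) x v := by
    rw [dirDeriv_congr hV hx (fun y hy => (F.hyperhermitian (hVU hy)).skew i (X y) (Y y)),
      dirDeriv, mvfderiv_fun_neg]
    rfl
  have hJ := (F.hyperhermitian (hVU hx)).skew i
  simp only [map_sub, LinearMap.sub_apply, hJ] at h1 h2 ⊢
  linarith

/-- `∇_v I_i` is a tensor: by `form_covH_J_skew`, the pairing of `(∇_v I_i) X` with a fixed section
only depends on the value of `X` at `x`. -/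
theorem covJ_eq (hcov : IsAssociatedConnection g W cov) (hV : IsOpen V) (hVU : V ⊆ U)
    (hx : x ∈ V) (hX : SmoothSection X V) (i : Fin 3) (v : TangentSpace (𝓡 7) x) :
    covH W cov (fun y => F.J i y (X y)) x v - F.J i x (covH W cov X x v)
      = F.covJ cov i x v (X x) := by
  refine (F.hyperhermitian (hVU hx)).eq_of_pairing fun z => ?_
  have hO : IsOpen (V ∩ F.nhd x) := hV.inter (F.isOpen_nhd x)
  have hOU : V ∩ F.nhd x ⊆ U := Set.inter_subset_left.trans hVU
  have hxO : x ∈ V ∩ F.nhd x := ⟨hx, F.mem_nhd (hVU hx)⟩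
  have hext : ∀ a : Q.fiber x, SmoothSection (extendH W a) (V ∩ F.nhd x) := fun a =>
    (F.smoothSection_extendH a).mono Set.inter_subset_right
  have h1 := F.form_covH_J_skew hcov hO hOU hxO (hX.mono Set.inter_subset_left) (hext z) i v
  have h2 := F.form_covH_J_skew hcov hO hOU hxO (hext (X x)) (hext z) i v
  rw [extendH_self] at h1 h2
  rw [h1, covJ, h2, extendH_self]

theorem covJ_skew (hcov : IsAssociatedConnection g W cov) (hx : x ∈ U) (i : Fin 3)
    (v : TangentSpace (𝓡 7) x) (a b : Q.fiber x) :
    g.form x (F.covJ cov i x v a) b = - g.form x a (F.covJ cov i x v b) := by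
  have h := F.form_covH_J_skew hcov (F.isOpen_nhd x) (F.nhd_subset x) (F.mem_nhd hx)
    (F.smoothSection_extendH a) (F.smoothSection_extendH b) i v
  rwa [extendH_self, extendH_self] at h

/-- The derivative of the relation `I_j I_k + I_k I_j = -2 δ_{jk}`. -/
theorem covJ_clifford (hcov : IsAssociatedConnection g W cov) (hx : x ∈ U) (j k : Fin 3)
    (v : TangentSpace (𝓡 7) x) (a : Q.fiber x) :
    F.covJ cov j x v (F.J k x a) + F.J j x (F.covJ cov k x v a)
      + F.covJ cov k x v (F.J j x a) + F.J k x (F.covJ cov j x v a) = 0 := by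
  have hO := F.isOpen_nhd x
  have hOU := F.nhd_subset x
  have hxO := F.mem_nhd hx
  have ha := F.smoothSection_extendH a
  have hJa := fun i => F.smoothSection_J hO hOU ha i
  have hsum := covH_add_eq_smul (W := W) (cov := cov) hO hxO (F.smoothSection_J hO hOU (hJa k) j)
    (F.smoothSection_J hO hOU (hJa j) k) ha
    (fun y hy => (F.hyperhermitian (hOU hy)).clifford j k (extendH W a y)) v
  have hjk := F.covJ_eq hcov hO hOU hxO (hJa k) j v
  have hkj := F.covJ_eq hcov hO hOU hxO (hJa j) k v
  have hj := F.covJ_eq hcov hO hOU hxO ha j v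
  have hk := F.covJ_eq hcov hO hOU hxO ha k v
  simp only [extendH_self] at hjk hkj hj hk
  have hc := (F.hyperhermitian hx).clifford j k (covH W cov (extendH W a) x v)
  rw [← hjk, ← hkj, ← hj, ← hk, map_sub, map_sub]
  rw [← hc] at hsum
  rw [← sub_eq_zero] at hsum
  rw [← hsum]
  abel

theorem dirDeriv_form_J (hcov : IsAssociatedConnection g W cov) (hV : IsOpen V) (hVU : V ⊆ U)
    (hx : x ∈ V) (hX : SmoothSection X V) (hY : SmoothSection Y V) (i : Fin 3)
    (v : TangentSpace (𝓡 7) x) :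
    dirDeriv (fun y => g.form y (F.J i y (X y)) (Y y)) x v
      = g.form x (F.J i x (covH W cov X x v)) (Y x) + g.form x (F.J i x (X x)) (covH W cov Y x v)
        + g.form x (F.covJ cov i x v (X x)) (Y x) := by
  rw [dirDeriv_form hcov hV hx (F.smoothSection_J hV hVU hX i) hY, ← F.covJ_eq hcov hV hVU hx hX]
  simp only [map_sub, LinearMap.sub_apply]
  ring

theorem covJ_smul (i : Fin 3) (c : ℝ) (v : TangentSpace (𝓡 7) x) (a : Q.fiber x) :
    F.covJ cov i x (c • v) a = c • F.covJ cov i x v a := by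
  simp only [covJ, covH_smul, map_smul, smul_sub]

end AdaptedFrame

end Sections

/-! ### Torsion and structure equations -/

section Torsion

variable {M : Type*} [TopologicalSpace M] [ChartedSpace E7 M] [IsManifold (𝓡 7) ∞ M]
  {Q : QCStructure M} {g : CompatibleMetric Q} {W : Complement Q} {U V : Set M} {x : M}

namespace AdaptedFrame

variable (F : AdaptedFrame g W U) {cov : Connection M} {X Y : (y : M) → Q.fiber y}

/-- The connection form `η_j(∇_v R_i)` of the connection induced on `W`. -/
def theta (cov : Connection M) (i j : Fin 3) (x : M) (v : TangentSpace (𝓡 7) x) : ℝ :=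
  F.η j x (cov (fun y => (F.R i y : TangentSpace (𝓡 7) y)) x v)

/-- The coefficient `η_j(T^W_a R_i)` of the vertical torsion. -/
def vt (cov : Connection M) (i j : Fin 3) (x : M) (a : Q.fiber x) : ℝ :=
  F.η j x (torsionW W cov x a (F.R i x))

theorem vt_sub (i j : Fin 3) (a b : Q.fiber x) :
    F.vt cov i j x (a - b) = F.vt cov i j x a - F.vt cov i j x b := by
  simp [vt, torsionW]

theorem vt_zero (i j : Fin 3) : F.vt cov i j x 0 = 0 := by
  simp [vt, torsionW]

theorem theta_neg (i j : Fin 3) (v : TangentSpace (𝓡 7) x) :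
    F.theta cov i j x (-v) = - F.theta cov i j x v := by
  simp [theta]

theorem theta_antisymm (hcov : IsAssociatedConnection g W cov) (hx : x ∈ U) (i j : Fin 3)
    (v : TangentSpace (𝓡 7) x) : F.theta cov i j x v = - F.theta cov j i x v := by
  have h := hcov.metric_W U F _ _ (F.smoothSection_R i) (F.smoothSection_R j) x hx v
  rw [F.metricW_comm (F.R i x), F.metricW_R_right hx, F.metricW_R_right hx, F.eta_projW hx,
    F.eta_projW hx, dirDeriv_eq_zero F.isOpen hx (if i = j then 1 else 0)] at h
  · exact eq_neg_of_add_eq_zero_left h.symm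
  · intro y hy
    rw [F.metricW_R_right hy, F.dual i j y hy]

theorem vt_symm (hcov : IsAssociatedConnection g W cov) (hx : x ∈ U) (i j : Fin 3)
    (a : Q.fiber x) : F.vt cov i j x a = F.vt cov j i x a := by
  have h := hcov.torsionW_symm U F x hx a (F.R i x) (F.R j x)
  rwa [F.metricW_comm (F.R i x), F.metricW_R_right hx, F.metricW_R_right hx] at h

theorem eta_eq_zero (hx : x ∈ U) (j : Fin 3) (a : Q.fiber x) :
    F.η j x (a : TangentSpace (𝓡 7) x) = 0 := F.vanish j x hx _ a.2

theorem smoothField_R (i : Fin 3) (hVU : V ⊆ U) :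
    SmoothField (fun y => (F.R i y : TangentSpace (𝓡 7) y)) V :=
  SmoothField.mono (F.smoothSection_R i) hVU

/-- `η_k([X, R_i])`, in terms of the connection form of `W` and of the vertical torsion. -/
theorem eta_bracket_R (hcov : IsAssociatedConnection g W cov) (hV : IsOpen V) (hVU : V ⊆ U)
    (hx : x ∈ V) (hX : SmoothSection X V) (i j : Fin 3) :
    F.η j x (mlieBracket (𝓡 7) (fun y => (X y : TangentSpace (𝓡 7) y))
      (fun y => (F.R i y : TangentSpace (𝓡 7) y)) x)
      = F.theta cov i j x (X x) - F.vt cov i j x (X x) := by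
  have h := cov.torsion_apply (SmoothField.mdifferentiableAt hX hV hx)
    ((F.smoothField_R i hVU).mdifferentiableAt hV hx)
  have h' := congrArg (F.η j x) h
  rw [map_sub, map_sub, ← coe_covH hcov hV hx hX, F.eta_eq_zero (hVU hx)] at h'
  rw [vt, torsionW, F.eta_projW (hVU hx), h', theta]
  ring

theorem extDerivFields_R (hcov : IsAssociatedConnection g W cov) (hV : IsOpen V) (hVU : V ⊆ U)
    (hx : x ∈ V) (hX : SmoothSection X V) (i j : Fin 3) :
    extDerivFields (F.η j) (fun y => (X y : TangentSpace (𝓡 7) y))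
      (fun y => (F.R i y : TangentSpace (𝓡 7) y)) x
      = F.vt cov j i x (X x) + F.theta cov j i x (X x) := by
  rw [extDerivFields_of_const hV hx 0 (if i = j then 1 else 0)
    (fun y hy => F.eta_eq_zero (hVU hy) j (X y)) (fun y hy => F.dual i j y (hVU hy)),
    F.eta_bracket_R hcov hV hVU hx hX, F.vt_symm hcov (hVU hx) j i,
    F.theta_antisymm hcov (hVU hx) j i]
  ring

theorem extDerivFields_H (hV : IsOpen V) (hVU : V ⊆ U) (hx : x ∈ V) (hX : SmoothSection X V)
    (hY : SmoothSection Y V) (j : Fin 3) :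
    extDerivFields (F.η j) (fun y => (X y : TangentSpace (𝓡 7) y))
      (fun y => (Y y : TangentSpace (𝓡 7) y)) x = g.form x (F.J j x (X x)) (Y x) := by
  rw [extDerivFields_of_const hV hx 0 0 (fun y hy => F.eta_eq_zero (hVU hy) j (X y))
    (fun y hy => F.eta_eq_zero (hVU hy) j (Y y)), F.form_J_apply hV hVU hx hX hY]

theorem contMDiffOn_extDerivFields_R (hV : IsOpen V) (hVU : V ⊆ U) (hX : SmoothSection X V)
    (i j : Fin 3) :
    ContMDiffOn (𝓡 7) 𝓘(ℝ, ℝ) ∞ (extDerivFields (F.η j)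
      (fun y => (X y : TangentSpace (𝓡 7) y)) (fun y => (F.R i y : TangentSpace (𝓡 7) y))) V :=
  (((F.smooth j).mono hVU).contMDiffOn_apply
    (SmoothField.mlieBracket hX (F.smoothField_R i hVU) hV)).neg.congr fun _ hy =>
    extDerivFields_of_const hV hy 0 (if i = j then 1 else 0)
      (fun y hy => F.eta_eq_zero (hVU hy) j (X y)) (fun y hy => F.dual i j y (hVU hy))

/-- The symmetric part of the structure equations:
`η_j(T^W_X R_i) = -½ (L_{R_i} η_j + L_{R_j} η_i)(X)`. In particular the vertical torsion is
smooth. -/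
theorem vt_eq_extDerivFields (hcov : IsAssociatedConnection g W cov) (hV : IsOpen V)
    (hVU : V ⊆ U) (hx : x ∈ V) (hX : SmoothSection X V) (i j : Fin 3) :
    F.vt cov i j x (X x) = (1 / 2 : ℝ) *
      (extDerivFields (F.η j) (fun y => (X y : TangentSpace (𝓡 7) y))
          (fun y => (F.R i y : TangentSpace (𝓡 7) y)) x
        + extDerivFields (F.η i) (fun y => (X y : TangentSpace (𝓡 7) y))
          (fun y => (F.R j y : TangentSpace (𝓡 7) y)) x) := by
  rw [F.extDerivFields_R hcov hV hVU hx hX, F.extDerivFields_R hcov hV hVU hx hX,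
    F.vt_symm hcov (hVU hx) j i, F.theta_antisymm hcov (hVU hx) j i]
  ring

theorem contMDiffOn_vt (hcov : IsAssociatedConnection g W cov) (hV : IsOpen V) (hVU : V ⊆ U)
    (hX : SmoothSection X V) (i j : Fin 3) :
    ContMDiffOn (𝓡 7) 𝓘(ℝ, ℝ) ∞ (fun y => F.vt cov i j y (X y)) V :=
  (contMDiffOn_const.mul ((F.contMDiffOn_extDerivFields_R hV hVU hX i j).add
    (F.contMDiffOn_extDerivFields_R hV hVU hX j i))).congr fun _ hy =>
    F.vt_eq_extDerivFields hcov hV hVU hy hX i j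

theorem dirDeriv_vt (hcov : IsAssociatedConnection g W cov) (hV : IsOpen V) (hVU : V ⊆ U)
    (hx : x ∈ V) (hX : SmoothSection X V) (i j : Fin 3) (v : TangentSpace (𝓡 7) x) :
    2 * dirDeriv (fun y => F.vt cov i j y (X y)) x v
      = dirDeriv (extDerivFields (F.η j) (fun y => (X y : TangentSpace (𝓡 7) y))
          (fun y => (F.R i y : TangentSpace (𝓡 7) y))) x v
        + dirDeriv (extDerivFields (F.η i) (fun y => (X y : TangentSpace (𝓡 7) y))
          (fun y => (F.R j y : TangentSpace (𝓡 7) y))) x v := by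
  have hd := fun i j => ((F.contMDiffOn_extDerivFields_R hV hVU hX i j).contMDiffAt
    (hV.mem_nhds hx)).mdifferentiableAt (by simp)
  rw [dirDeriv_congr hV hx (fun y hy => F.vt_eq_extDerivFields hcov hV hVU hy hX i j)]
  simp only [dirDeriv]
  have hsum : MDifferentiableAt (𝓡 7) 𝓘(ℝ, ℝ) (fun y =>
      extDerivFields (F.η j) (fun y => (X y : TangentSpace (𝓡 7) y))
          (fun y => (F.R i y : TangentSpace (𝓡 7) y)) y
        + extDerivFields (F.η i) (fun y => (X y : TangentSpace (𝓡 7) y))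
          (fun y => (F.R j y : TangentSpace (𝓡 7) y)) y) x := (hd i j).add (hd j i)
  rw [mvfderiv_fun_mul mdifferentiableAt_const hsum, mvfderiv_fun_add (hd i j) (hd j i),
    mvfderiv_const]
  simp
  ring

/-- The exterior derivative `(dη_j)_x`. -/
def dEta (hx : x ∈ U) (j : Fin 3) : TangentSpace (𝓡 7) x →L[ℝ] TangentSpace (𝓡 7) x →L[ℝ] ℝ :=
  extDerivHom ((F.smooth j).formMDiffAt F.isOpen hx)

theorem dEta_H_H (hx : x ∈ U) (j : Fin 3) (a b : Q.fiber x) :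
    F.dEta hx j a b = g.form x (F.J j x a) b :=
  F.extDeriv_eq j x hx a b

theorem dEta_H_R (hcov : IsAssociatedConnection g W cov) (hx : x ∈ U) (i j : Fin 3)
    (a : Q.fiber x) :
    F.dEta hx j a (F.R i x) = F.vt cov j i x a + F.theta cov j i x a := by
  have hO := F.isOpen_nhd x
  have hOU := F.nhd_subset x
  have hxO := F.mem_nhd hx
  have h := extDerivHom_apply ((F.smooth j).formMDiffAt F.isOpen hx) hO hxO
    (F.smoothSection_extendH a) (F.smoothField_R i hOU)
  have h' := F.extDerivFields_R hcov hO hOU hxO (F.smoothSection_extendH a) i j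
  rw [extendH_self] at h h'
  exact h.trans h'

theorem dEta_R_H (hcov : IsAssociatedConnection g W cov) (hx : x ∈ U) (i j : Fin 3)
    (a : Q.fiber x) :
    F.dEta hx j (F.R i x) a = -(F.vt cov j i x a + F.theta cov j i x a) := by
  rw [← F.dEta_H_R hcov hx]
  exact extDerivHom_swap _ _ _

theorem dEta_R_R (hcov : IsAssociatedConnection g W cov) (hx : x ∈ U) (i j k : Fin 3) :
    F.dEta hx j (F.R k x) (F.R i x)
      = F.theta cov j i x (F.R k x) - F.theta cov j k x (F.R i x) := by
  have hR := fun i => F.smoothField_R i (subset_refl U)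
  have h := extDerivHom_apply ((F.smooth j).formMDiffAt F.isOpen hx) F.isOpen hx (hR k) (hR i)
  rw [extDerivFields_of_const F.isOpen hx (if k = j then 1 else 0) (if i = j then 1 else 0)
    (F.dual k j) (F.dual i j)] at h
  have ht := cov.torsion_apply ((hR k).mdifferentiableAt F.isOpen hx)
    ((hR i).mdifferentiableAt F.isOpen hx)
  have ht' := congrArg (F.η j x) ht
  rw [map_sub, map_sub, ← F.eta_projW hx, hcov.torsion_WW] at ht'
  simp only [ZeroMemClass.coe_zero, map_zero] at ht'
  rw [dEta, h, F.theta_antisymm hcov hx j i, F.theta_antisymm hcov hx j k]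
  simp only [theta]
  linarith

theorem bracket_H_H (hcov : IsAssociatedConnection g W cov) (hV : IsOpen V) (hVU : V ⊆ U)
    (hx : x ∈ V) (hX : SmoothSection X V) (hY : SmoothSection Y V) :
    mlieBracket (𝓡 7) (fun y => (X y : TangentSpace (𝓡 7) y))
      (fun y => (Y y : TangentSpace (𝓡 7) y)) x
      = ((covH W cov Y x (X x) - covH W cov X x (Y x) : Q.fiber x) : TangentSpace (𝓡 7) x)
        + ∑ k, (- g.form x (F.J k x (X x)) (Y x)) • (F.R k x : TangentSpace (𝓡 7) x) := by
  have ht := cov.torsion_apply (SmoothField.mdifferentiableAt hX hV hx)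
    (SmoothField.mdifferentiableAt hY hV hx)
  have ht' := congrArg (W.projH x) ht
  rw [hcov.torsion_HH, map_sub, map_sub] at ht'
  rw [F.decomp (hVU hx) (mlieBracket (𝓡 7) _ _ x), ← sub_eq_zero.mp ht'.symm]
  congr 1
  refine Finset.sum_congr rfl fun k _ => ?_
  rw [F.form_J_apply hV hVU hx hX hY, neg_neg]

theorem bracket_H_R (hcov : IsAssociatedConnection g W cov) (hV : IsOpen V) (hVU : V ⊆ U)
    (hx : x ∈ V) (hX : SmoothSection X V) (i : Fin 3) :
    mlieBracket (𝓡 7) (fun y => (X y : TangentSpace (𝓡 7) y))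
      (fun y => (F.R i y : TangentSpace (𝓡 7) y)) x
      = ((torsionH W cov x (F.R i x) (X x) - covH W cov X x (F.R i x) : Q.fiber x) :
          TangentSpace (𝓡 7) x)
        + ∑ k, (F.theta cov i k x (X x) - F.vt cov i k x (X x)) •
            (F.R k x : TangentSpace (𝓡 7) x) := by
  have ht := cov.torsion_apply (SmoothField.mdifferentiableAt hX hV hx)
    ((F.smoothField_R i hVU).mdifferentiableAt hV hx)
  have ht' := congrArg (W.projH x) ht
  rw [cov.torsion_antisymm, map_sub, map_sub, map_neg, W.projH_of_mem_fiber x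
    (hcov.preserves_W V (F.R i) hV ((F.smoothSection_R i).mono hVU) x hx _)] at ht'
  have h2 : W.projH x (mlieBracket (𝓡 7) (fun y => (X y : TangentSpace (𝓡 7) y))
      (fun y => (F.R i y : TangentSpace (𝓡 7) y)) x)
      = torsionH W cov x (F.R i x) (X x) - covH W cov X x (F.R i x) := by
    rw [torsionH, covH]
    exact eq_sub_of_add_eq (neg_injective (Eq.trans (by abel) ht'.symm))
  rw [F.decomp (hVU hx) (mlieBracket (𝓡 7) _ _ x), h2]
  congr 1
  refine Finset.sum_congr rfl fun k _ => ?_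
  rw [F.eta_bracket_R hcov hV hVU hx hX]

/-! ### The first Bianchi identity -/

/-- The component of the first Bianchi identity in `Λ³H* ⊗ W`, from `d(dη_j) = 0` on three sections
of `H`. -/
theorem bianchi_H_H_H (hcov : IsAssociatedConnection g W cov) (hx : x ∈ U) (j : Fin 3)
    (a b c : Q.fiber x) :
    g.form x (F.covJ cov j x a b) c + g.form x (F.covJ cov j x b c) a
        + g.form x (F.covJ cov j x c a) b
      = ∑ k, (g.form x (F.J k x a) b * (F.vt cov j k x c + F.theta cov j k x c)
        + g.form x (F.J k x b) c * (F.vt cov j k x a + F.theta cov j k x a)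
        + g.form x (F.J k x c) a * (F.vt cov j k x b + F.theta cov j k x b)) := by
  have hO := F.isOpen_nhd x
  have hOU := F.nhd_subset x
  have hxO := F.mem_nhd hx
  have hs := fun a : Q.fiber x => F.smoothSection_extendH a
  have h := extDeriv_extDeriv_of_const ((F.smooth j).mono hOU) hO hxO (hs a) (hs b) (hs c)
    (fun y hy => F.eta_eq_zero (hOU hy) j _) (fun y hy => F.eta_eq_zero (hOU hy) j _)
    (fun y hy => F.eta_eq_zero (hOU hy) j _)
  have hd : ∀ (a b : Q.fiber x) (v : TangentSpace (𝓡 7) x),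
      dirDeriv (fun y => extDerivFields (F.η j)
        (fun y => (extendH W a y : TangentSpace (𝓡 7) y))
        (fun y => (extendH W b y : TangentSpace (𝓡 7) y)) y) x v
      = g.form x (F.J j x (covH W cov (extendH W a) x v)) b
        + g.form x (F.J j x a) (covH W cov (extendH W b) x v)
        + g.form x (F.covJ cov j x v a) b := by
    intro a b v
    rw [dirDeriv_congr hO hxO (fun y hy => F.extDerivFields_H hO hOU hy (hs a) (hs b) j),
      F.dirDeriv_form_J hcov hO hOU hxO (hs a) (hs b)]
    simp only [extendH_self]
  have hb : ∀ a b c : Q.fiber x,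
      extDerivHom (((F.smooth j).mono hOU).formMDiffAt hO hxO) (mlieBracket (𝓡 7)
        (fun y => (extendH W a y : TangentSpace (𝓡 7) y))
        (fun y => (extendH W b y : TangentSpace (𝓡 7) y)) x) (extendH W c x)
      = g.form x (F.J j x (covH W cov (extendH W b) x a)) c
        - g.form x (F.J j x (covH W cov (extendH W a) x b)) c
        + ∑ k, g.form x (F.J k x a) b * (F.vt cov j k x c + F.theta cov j k x c) := by
    intro a b c
    change F.dEta hx j _ _ = _
    rw [F.bracket_H_H hcov hO hOU hxO (hs a) (hs b)]
    simp only [extendH_self]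
    simp only [map_add, map_sum, map_smul, add_apply,
      sum_apply, smul_apply, F.dEta_H_H,
      F.dEta_R_H hcov, map_sub, LinearMap.sub_apply, smul_eq_mul, neg_mul_neg]
  rw [hd, hd, hd, hb, hb, hb] at h
  simp only [extendH_self] at h
  have hJ := F.hyperhermitian hx
  have hw : ∀ a b : Q.fiber x, g.form x (F.J j x a) b = - g.form x (F.J j x b) a :=
    fun a b => by rw [hJ.skew, hJ.symm]
  rw [hw a, hw b, hw c] at h
  simp only [Finset.sum_add_distrib]
  linarith

/-- The relation `d(dη_j) = 0` on two sections of `H` and the field `R_i`. The first two terms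
are derivatives of `η_j(T^W_X R_i) - η_j(∇_X R_i)`. -/
theorem bianchi_H_H_R (hcov : IsAssociatedConnection g W cov) (hx : x ∈ U) (i j : Fin 3)
    (a b : Q.fiber x) :
    dirDeriv (extDerivFields (F.η j) (fun y => (extendH W b y : TangentSpace (𝓡 7) y))
        (fun y => (F.R i y : TangentSpace (𝓡 7) y))) x a
      - dirDeriv (extDerivFields (F.η j) (fun y => (extendH W a y : TangentSpace (𝓡 7) y))
        (fun y => (F.R i y : TangentSpace (𝓡 7) y))) x b
      + g.form x (F.covJ cov j x (F.R i x) a) b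
      = F.vt cov j i x (covH W cov (extendH W b) x a - covH W cov (extendH W a) x b)
        + F.theta cov j i x
            (covH W cov (extendH W b) x a - covH W cov (extendH W a) x b : Q.fiber x)
        - ∑ k, g.form x (F.J k x a) b
            * (F.theta cov j i x (F.R k x) - F.theta cov j k x (F.R i x))
        - g.form x (F.J j x (torsionH W cov x (F.R i x) a)) b
        - g.form x (F.J j x a) (torsionH W cov x (F.R i x) b)
        - ∑ k, (F.theta cov i k x b - F.vt cov i k x b) * (F.vt cov j k x a + F.theta cov j k x a)
        + ∑ k, (F.theta cov i k x a - F.vt cov i k x a)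
            * (F.vt cov j k x b + F.theta cov j k x b) := by
  have hO := F.isOpen_nhd x
  have hOU := F.nhd_subset x
  have hxO := F.mem_nhd hx
  have hs := fun a : Q.fiber x => F.smoothSection_extendH a
  have h := extDeriv_extDeriv_of_const ((F.smooth j).mono hOU) hO hxO (hs a) (hs b)
    (F.smoothField_R i hOU)
    (fun y hy => F.eta_eq_zero (hOU hy) j _) (fun y hy => F.eta_eq_zero (hOU hy) j _)
    (fun y hy => F.dual i j y (hOU hy))
  have hswap : ∀ v, dirDeriv (fun y => extDerivFields (F.η j)
      (fun y => (F.R i y : TangentSpace (𝓡 7) y))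
      (fun y => (extendH W a y : TangentSpace (𝓡 7) y)) y) x v
      = - dirDeriv (extDerivFields (F.η j)
        (fun y => (extendH W a y : TangentSpace (𝓡 7) y))
        (fun y => (F.R i y : TangentSpace (𝓡 7) y))) x v := by
    intro v
    rw [dirDeriv_congr hO hxO (fun y _ => extDerivFields_swap y), dirDeriv, mvfderiv_fun_neg]
    rfl
  have hHH : extDerivHom (((F.smooth j).mono hOU).formMDiffAt hO hxO) (mlieBracket (𝓡 7)
        (fun y => (extendH W a y : TangentSpace (𝓡 7) y))
        (fun y => (extendH W b y : TangentSpace (𝓡 7) y)) x) (F.R i x)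
      = F.vt cov j i x (covH W cov (extendH W b) x a - covH W cov (extendH W a) x b)
        + F.theta cov j i x
            (covH W cov (extendH W b) x a - covH W cov (extendH W a) x b : Q.fiber x)
        - ∑ k, g.form x (F.J k x a) b
            * (F.theta cov j i x (F.R k x) - F.theta cov j k x (F.R i x)) := by
    change F.dEta hx j _ _ = _
    rw [F.bracket_H_H hcov hO hOU hxO (hs a) (hs b)]
    simp only [extendH_self]
    simp only [map_add, map_sum, map_smul, add_apply,
      sum_apply, smul_apply, F.dEta_H_R hcov,
      F.dEta_R_R hcov, smul_eq_mul, neg_mul, Finset.sum_neg_distrib, sub_eq_add_neg]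
  have hHR : ∀ a b : Q.fiber x,
      extDerivHom (((F.smooth j).mono hOU).formMDiffAt hO hxO) (mlieBracket (𝓡 7)
        (fun y => (extendH W a y : TangentSpace (𝓡 7) y))
        (fun y => (F.R i y : TangentSpace (𝓡 7) y)) x) (extendH W b x)
      = g.form x (F.J j x (torsionH W cov x (F.R i x) a)) b
        - g.form x (F.J j x (covH W cov (extendH W a) x (F.R i x))) b
        - ∑ k, (F.theta cov i k x a - F.vt cov i k x a)
            * (F.vt cov j k x b + F.theta cov j k x b) := by
    intro a b
    change F.dEta hx j _ _ = _
    rw [F.bracket_H_R hcov hO hOU hxO (hs a)]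
    simp only [extendH_self]
    simp only [map_add, map_sum, map_smul, add_apply,
      sum_apply, smul_apply, F.dEta_H_H,
      F.dEta_R_H hcov, map_sub, LinearMap.sub_apply, smul_eq_mul, mul_neg,
      Finset.sum_neg_distrib]
    ring
  rw [mlieBracket_swap_apply (V := fun y => (F.R i y : TangentSpace (𝓡 7) y)), map_neg,
    neg_apply, hswap, hHH, hHR, hHR,
    dirDeriv_congr hO hxO (fun y hy => F.extDerivFields_H hO hOU hy (hs a) (hs b) j),
    F.dirDeriv_form_J hcov hO hOU hxO (hs a) (hs b)] at h
  simp only [extendH_self] at h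
  have hJ := F.hyperhermitian hx
  have hw : ∀ a b : Q.fiber x, g.form x (F.J j x a) b = - g.form x (F.J j x b) a :=
    fun a b => by rw [hJ.skew, hJ.symm]
  rw [hw a (covH W cov (extendH W b) x (F.R i x)),
    hw (torsionH W cov x (F.R i x) b) a] at h
  linarith

end AdaptedFrame
end Torsion

/-! ### The Bianchi operator on the vertical torsion -/

section Bianchi

variable {M : Type*} [TopologicalSpace M] [ChartedSpace E7 M] [IsManifold (𝓡 7) ∞ M]
  {Q : QCStructure M} {g : CompatibleMetric Q} {W : Complement Q} {U V : Set M} {x : M}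

namespace AdaptedFrame

variable (F : AdaptedFrame g W U) {cov : Connection M}

/-- The defining relation of `S^{5,1}`, in terms of the coefficients of the vertical torsion. -/
theorem sum_vt_J (hW : IsAdaptedComplement g W cov) (hx : x ∈ U) (j : Fin 3) (u : Q.fiber x) :
    ∑ k, F.vt cov k j x (F.J k x u) = 0 := by
  have hJ := F.hyperhermitian hx
  obtain ⟨a, -, ha, h⟩ := hW U F x hx
  have hc := hJ.tensorOfCoeff_injective (Q.finrank_fiber x) h
  have hvt : ∀ k b, F.vt cov k j x b = g.form x (a k j) b := fun k b =>
    congrFun (congrFun (congrFun hc k) j) b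
  have h0 := congrArg (fun z => g.form x z u) (ha j)
  simp only [map_sum, LinearMap.sum_apply, hJ.skew, map_zero, LinearMap.zero_apply,
    Finset.sum_neg_distrib, neg_eq_zero] at h0
  simpa only [hvt] using h0

/-- The identification `R_i ↦ w_i` of `W` with `Λ²₊ H*` is parallel in the directions of `H`: this
is what singles out the adapted complement. -/
theorem covJ_H (hcov : IsAssociatedConnection g W cov) (hW : IsAdaptedComplement g W cov)
    (hx : x ∈ U) (j : Fin 3) (v a : Q.fiber x) :
    F.covJ cov j x v a = ∑ k, F.theta cov j k x v • F.J k x a := by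
  have hJ := F.hyperhermitian hx
  have h4 := Q.finrank_fiber x
  obtain ⟨u, hu⟩ := hJ.exists_unit h4
  have hder := fun v : TangentSpace (𝓡 7) x => hJ.derivation_eq h4 hu
    (p := fun i a => F.covJ cov i x v a) (fun i a b => F.covJ_skew hcov hx i v a b)
    (fun j k a => F.covJ_clifford hcov hx j k v a)
  -- the difference of the two connection forms, on `Λ²₊ H*` and on `W`
  let β : Fin 3 → Fin 3 → Q.fiber x → ℝ := fun j k v =>
    g.form x (F.covJ cov j x v u) (F.J k x u) - F.theta cov j k x v
  have hodd : ∀ j k v, β j k (-v) = - β j k v := by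
    intro j k v
    have := F.covJ_smul (cov := cov) j (-1) (v : TangentSpace (𝓡 7) x) u
    simp only [neg_one_smul] at this
    simp only [β, NegMemClass.coe_neg, this, F.theta_neg, map_neg, LinearMap.neg_apply]
    ring
  have hanti : ∀ j k v, β j k v = - β k j v := by
    intro j k v
    simp only [β]
    rw [(hder v).1 j k, F.theta_antisymm hcov hx j k]
    ring
  have hβ0 : ∀ j k, β j k 0 = 0 := fun j k => by
    have := hodd j k 0
    rw [neg_zero] at this
    linarith
  have hsum : ∀ j u, ∑ k, β j k (F.J k x u) = 0 := by
    intro j u'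
    have h := hJ.sum_apply_J_eq_zero (γ := fun k v => β j k v - F.vt cov j k x v)
      (fun k => by rw [hβ0, F.vt_zero, sub_zero]) (fun X Y Z => ?_) u'
    · simp only [Finset.sum_sub_distrib] at h
      have h0 := F.sum_vt_J hW hx j u'
      simp only [F.vt_symm hcov hx _ j] at h0
      linarith
    · have h := F.bianchi_H_H_H hcov hx j X Y Z
      rw [(hder X).2 j Y, (hder Y).2 j Z, (hder Z).2 j X] at h
      rw [← sub_eq_zero] at h
      rw [← h]
      simp only [β, Fin.sum_univ_three, map_add, map_smul, LinearMap.add_apply,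
        LinearMap.smul_apply, smul_eq_mul]
      ring
  have hβ := hJ.antisymm_eq_zero hodd hanti hsum
  rw [(hder v).2 j a]
  refine Finset.sum_congr rfl fun k _ => ?_
  rw [sub_eq_zero.mp (hβ j k v)]

/-- The coefficient of `(∇_a T^W)_b` on `w_l ⊗ w_m`, with the covariant derivative induced by the
connection form of `W`. -/
def dvt (cov : Connection M) (l m : Fin 3) (x : M) (a b : Q.fiber x) : ℝ :=
  dirDeriv (fun y => F.vt cov l m y (extendH W b y)) x a
    - F.vt cov l m x (covH W cov (extendH W b) x a)
    - ∑ p, (F.theta cov l p x a * F.vt cov m p x b + F.theta cov m p x a * F.vt cov l p x b)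

/-- By `covJ_H`, the connection on `Λ²₊ H*` induced from `H` can be replaced by that of `W`. -/
theorem covTensor_verticalTorsion (hcov : IsAssociatedConnection g W cov)
    (hW : IsAdaptedComplement g W cov) (hx : x ∈ U) (a b : Q.fiber x) (Z : Fin 4 → Q.fiber x) :
    covTensor W cov (F.verticalTorsion cov) x a (Fin.cons b Z)
      = ∑ l, ∑ m, F.dvt cov l m x a b * g.form x (F.J l x (Z 0)) (Z 1)
          * g.form x (F.J m x (Z 2)) (Z 3) := by
  have hO := F.isOpen_nhd x
  have hOU := F.nhd_subset x
  have hxO := F.mem_nhd hx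
  have hs := fun a : Q.fiber x => F.smoothSection_extendH a
  have hvt : ∀ l m, MDifferentiableAt (𝓡 7) 𝓘(ℝ, ℝ)
      (fun y => F.vt cov l m y (extendH W b y)) x := fun l m =>
    ((F.contMDiffOn_vt hcov hO hOU (hs b) l m).contMDiffAt
      (hO.mem_nhds hxO)).mdifferentiableAt (by simp)
  have hw : ∀ l (c d : Q.fiber x), MDifferentiableAt (𝓡 7) 𝓘(ℝ, ℝ)
      (fun y => g.form y (F.J l y (extendH W c y)) (extendH W d y)) x := fun l c d =>
    ((F.contMDiffOn_form_J hO hOU (hs c) (hs d) l).contMDiffAt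
      (hO.mem_nhds hxO)).mdifferentiableAt (by simp)
  have hdw : ∀ l (c d : Q.fiber x), dirDeriv
      (fun y => g.form y (F.J l y (extendH W c y)) (extendH W d y)) x a
      = g.form x (F.J l x (covH W cov (extendH W c) x a)) d
        + g.form x (F.J l x c) (covH W cov (extendH W d) x a)
        + ∑ k, F.theta cov l k x a * g.form x (F.J k x c) d := by
    intro l c d
    rw [F.dirDeriv_form_J hcov hO hOU hxO (hs c) (hs d)]
    simp only [extendH_self, F.covJ_H hcov hW hx, map_sum, map_smul, LinearMap.sum_apply,
      LinearMap.smul_apply, smul_eq_mul]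
  have hder : dirDeriv (fun y => F.verticalTorsion cov y
        (fun i => extendH W ((Fin.cons b Z : Fin 5 → Q.fiber x) i) y)) x a
      = ∑ l, ∑ m, ((dirDeriv (fun y => F.vt cov l m y (extendH W b y)) x a
          * g.form x (F.J l x (Z 0)) (Z 1) + F.vt cov l m x b * dirDeriv
            (fun y => g.form y (F.J l y (extendH W (Z 0) y)) (extendH W (Z 1) y)) x a)
          * g.form x (F.J m x (Z 2)) (Z 3)
        + F.vt cov l m x b * g.form x (F.J l x (Z 0)) (Z 1) * dirDeriv
            (fun y => g.form y (F.J m y (extendH W (Z 2) y)) (extendH W (Z 3) y)) x a) := by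
    have h1 := fun l m => (hvt l m).mul (hw l (Z 0) (Z 1))
    have h2 := fun l m => (h1 l m).mul (hw m (Z 2) (Z 3))
    have h3 := fun l => dirDeriv_sum Finset.univ (fun m => h2 l m) (a : TangentSpace (𝓡 7) x)
    have h4 := dirDeriv_sum Finset.univ (fun l => (h3 l).1) (a : TangentSpace (𝓡 7) x)
    refine h4.2.trans (Finset.sum_congr rfl fun l _ => (h3 l).2.trans
      (Finset.sum_congr rfl fun m _ => ?_))
    refine (dirDeriv_mul (h1 l m) (hw m (Z 2) (Z 3)) _).trans ?_
    refine (congrArg₂ (· + ·) (congrArg₂ (· * ·) (dirDeriv_mul (hvt l m) (hw l (Z 0) (Z 1)) _)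
      rfl) rfl).trans ?_
    simp only [extendH_self, Pi.mul_apply]
  -- the terms of `∇_a σ` in which one of the arguments is differentiated
  have hσ : ∀ Y : Fin 5 → Q.fiber x, F.verticalTorsion cov x Y
      = ∑ l, ∑ m, F.vt cov l m x (Y 0) * g.form x (F.J l x (Y 1)) (Y 2)
        * g.form x (F.J m x (Y 3)) (Y 4) := fun _ => rfl
  have hupd : ∑ i : Fin 5, F.verticalTorsion cov x (Function.update (Fin.cons b Z) i
        (W.projH x (cov (fun y => (extendH W ((Fin.cons b Z : Fin 5 → Q.fiber x) i) y :
          TangentSpace (𝓡 7) y)) x a)))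
      = ∑ l, ∑ m, (F.vt cov l m x (covH W cov (extendH W b) x a)
            * g.form x (F.J l x (Z 0)) (Z 1) * g.form x (F.J m x (Z 2)) (Z 3)
        + F.vt cov l m x b * (g.form x (F.J l x (covH W cov (extendH W (Z 0)) x a)) (Z 1)
            + g.form x (F.J l x (Z 0)) (covH W cov (extendH W (Z 1)) x a))
          * g.form x (F.J m x (Z 2)) (Z 3)
        + F.vt cov l m x b * g.form x (F.J l x (Z 0)) (Z 1)
          * (g.form x (F.J m x (covH W cov (extendH W (Z 2)) x a)) (Z 3)
            + g.form x (F.J m x (Z 2)) (covH W cov (extendH W (Z 3)) x a))) := by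
    rw [Fin.sum_univ_five]
    simp only [hσ, ← Finset.sum_add_distrib]
    refine Finset.sum_congr rfl fun l _ => Finset.sum_congr rfl fun m _ => ?_
    rw [mul_add, mul_add, add_mul, ← add_assoc, ← add_assoc]
    rfl
  rw [covTensor, hder, hupd, ← Finset.sum_sub_distrib]
  simp only [← Finset.sum_sub_distrib, hdw]
  have hθ := fun j k => F.theta_antisymm hcov hx j k (a : TangentSpace (𝓡 7) x)
  have hθ0 : ∀ j, F.theta cov j j x (a : TangentSpace (𝓡 7) x) = 0 := fun j => by
    linarith [hθ j j]
  simp only [dvt, Fin.sum_univ_three, hθ0, hθ 1 0, hθ 2 0, hθ 2 1,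
    F.vt_symm hcov hx 1 0, F.vt_symm hcov hx 2 0, F.vt_symm hcov hx 2 1]
  ring

/-- The identity `bianchi_H_H_R` symmetrised in `i, j`: the derivatives of the connection form of
`W`, that is its curvature, and the terms quadratic in the torsion drop out. -/
theorem dvt_sub_swap (hcov : IsAssociatedConnection g W cov) (hx : x ∈ U) (i j : Fin 3)
    (a b : Q.fiber x) :
    2 * (F.dvt cov i j x a b - F.dvt cov i j x b a)
      = - (g.form x (F.covJ cov j x (F.R i x) a) b + g.form x (F.covJ cov i x (F.R j x) a) b)
        - (g.form x (F.J j x (torsionH W cov x (F.R i x) a)) b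
          + g.form x (F.J j x a) (torsionH W cov x (F.R i x) b))
        - (g.form x (F.J i x (torsionH W cov x (F.R j x) a)) b
          + g.form x (F.J i x a) (torsionH W cov x (F.R j x) b))
        + ∑ k, g.form x (F.J k x a) b
            * (F.theta cov j k x (F.R i x) + F.theta cov i k x (F.R j x)) := by
  have hO := F.isOpen_nhd x
  have hOU := F.nhd_subset x
  have hxO := F.mem_nhd hx
  have hij := F.bianchi_H_H_R hcov hx i j a b
  have hji := F.bianchi_H_H_R hcov hx j i a b
  have ha := F.dirDeriv_vt hcov hO hOU hxO (F.smoothSection_extendH a) i j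
    (b : TangentSpace (𝓡 7) x)
  have hb := F.dirDeriv_vt hcov hO hOU hxO (F.smoothSection_extendH b) i j
    (a : TangentSpace (𝓡 7) x)
  have hθ := F.theta_antisymm hcov hx j i
  simp only [F.vt_symm hcov hx j i, F.vt_sub, hθ, Fin.sum_univ_three] at hij hji
  simp only [dvt, Fin.sum_univ_three]
  linear_combination hb - ha + hij + hji

theorem dNabla_verticalTorsion (hcov : IsAssociatedConnection g W cov)
    (hW : IsAdaptedComplement g W cov) (hx : x ∈ U) (a b : Q.fiber x) (Z : Fin 4 → Q.fiber x) :
    dNabla W cov (F.verticalTorsion cov) x a b Z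
      = ∑ l, ∑ m, (F.dvt cov l m x a b - F.dvt cov l m x b a) * g.form x (F.J l x (Z 0)) (Z 1)
          * g.form x (F.J m x (Z 2)) (Z 3) := by
  rw [dNabla, F.covTensor_verticalTorsion hcov hW hx, F.covTensor_verticalTorsion hcov hW hx,
    ← Finset.sum_sub_distrib]
  simp only [← Finset.sum_sub_distrib, sub_mul]

theorem bianchiOp_verticalTorsion (hcov : IsAssociatedConnection g W cov)
    (hW : IsAdaptedComplement g W cov) (hx : x ∈ U) {e : Module.Basis (Fin 4) ℝ (Q.fiber x)}
    (he : IsOrthonormal (g.form x) e) :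
    bianchiOp W cov (F.verticalTorsion cov) x (fun i => F.J i x) e = 0 := by
  have hJ := F.hyperhermitian hx
  -- twice the trace of the torsion endomorphism `T^H_{R_i}`
  let s : Fin 3 → ℝ := fun i => 2 * ∑ a, g.form x (torsionH W cov x (F.R i x) (e a)) (e a)
  -- the antisymmetric coefficients of `∇_{R_i} w_j`
  let m : Fin 3 → Fin 3 → Fin 3 → ℝ := fun i j k =>
    ∑ a, g.form x (F.covJ cov j x (F.R i x) (e a)) (F.J k x (e a))
  have hm : ∀ i j k, m i j k = - m i k j := by
    intro i j k
    obtain ⟨u, hu⟩ := hJ.exists_unit (Q.finrank_fiber x)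
    obtain ⟨hanti, hexp⟩ := hJ.derivation_eq (Q.finrank_fiber x) hu
      (p := fun j a => F.covJ cov j x (F.R i x) a) (fun j a b => F.covJ_skew hcov hx j _ a b)
      (fun j k a => F.covJ_clifford hcov hx j k _ a)
    have hval : ∀ j k, m i j k = 4 * g.form x (F.covJ cov j x (F.R i x) u) (F.J k x u) := by
      intro j k
      simp only [m]
      rw [Finset.sum_congr rfl fun a _ => by rw [hexp j (e a)]]
      simp [hJ.J_J, he _ _]
    rw [hval, hval, hanti j k]
    ring
  have hC : ∀ k i j, selfDualCoeff (fun i => F.J i x) e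
      (dNabla W cov (F.verticalTorsion cov) x) k i j
      = (1 / 8) * (- (m i j k + m j i k) - (if j = k then s i else 0) - (if i = k then s j else 0)
        + 4 * (F.theta cov j k x (F.R i x) + F.theta cov i k x (F.R j x))) := by
    intro k i j
    rw [hJ.selfDualCoeff_eq he (d := fun l m a b => F.dvt cov l m x a b - F.dvt cov l m x b a)
      (F.dNabla_verticalTorsion hcov hW hx)]
    have hi := hJ.sum_symm he (hcov.torsionH_symm x (F.R i x)) j k
    have hj := hJ.sum_symm he (hcov.torsionH_symm x (F.R j x)) i k
    have h1 := Finset.sum_congr (rfl : (Finset.univ : Finset (Fin 4)) = Finset.univ) fun a _ =>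
      F.dvt_sub_swap hcov hx i j (e a) (F.J k x (e a))
    simp only [Finset.sum_add_distrib, Finset.sum_sub_distrib, Finset.sum_neg_distrib,
      ← Finset.mul_sum] at h1 hi hj ⊢
    have hlast : ∑ a, ∑ p, g.form x (F.J p x (e a)) (F.J k x (e a))
        * (F.theta cov j p x (F.R i x) + F.theta cov i p x (F.R j x))
        = 4 * (F.theta cov j k x (F.R i x) + F.theta cov i k x (F.R j x)) := by
      simp [hJ.J_J, he _ _]
      ring
    rw [hlast, hi, hj] at h1
    simp only [m, s]
    linarith
  refine projS60_eq_zero (t := fun i => - s i / 12) fun i j k => ?_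
  simp only [sym3, hC]
  simp only [eq_comm (a := k) (b := j), eq_comm (a := k) (b := i), eq_comm (a := j) (b := i)]
  have h1 := F.theta_antisymm hcov hx j k (F.R i x)
  have h2 := F.theta_antisymm hcov hx i k (F.R j x)
  have h3 := F.theta_antisymm hcov hx i j (F.R k x)
  have h4 := hm i j k
  have h5 := hm j i k
  have h6 := hm k i j
  split_ifs <;> linarith

end AdaptedFrame
end Bianchi

end QC

end

theorem lemma6 {M : Type*} [TopologicalSpace M] [ChartedSpace QC.E7 M] [IsManifold (𝓡 7) ∞ M]
    (Q : QC.QCStructure M) (g : QC.CompatibleMetric Q) (W : QC.Complement Q)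
    (cov : QC.Connection M) (hcov : QC.IsAssociatedConnection g W cov)
    (hW : QC.IsAdaptedComplement g W cov) :
    ∀ (U : Set M) (F : QC.AdaptedFrame g W U), ∀ x ∈ U,
      QC.MemS51 (g.form x) (fun i => F.J i x) (F.verticalTorsion cov x) ∧
      QC.MemDualS40 (g.form x) (fun i => F.J i x) (F.verticalTorsion cov x) ∧
      ∀ e : Module.Basis (Fin 4) ℝ (Q.fiber x), QC.IsOrthonormal (g.form x) e →
        QC.bianchiOp W cov (F.verticalTorsion cov) x (fun i => F.J i x) e = 0 := by
  intro U F x hx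
  have h := hW U F x hx
  exact ⟨h, (F.hyperhermitian hx).memDualS40 h, fun e he =>
    F.bianchiOp_verticalTorsion hcov hW hx he⟩
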